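/- Let $p\equiv 1\pmod 8$ be a prime, written as $p=a^2+4b^2$ with integers $a\equiv -1\pmod 4$ and $b>0$. Put $n=(p-1)/4$ and write $\{x\}_p$ for the least nonnegative residue of $x$ modulo $p$. Let $0<a_1<a_2<\cdots<a_n<p/2$ be all the quadratic residues modulo $p$ in the interval $(0,p/2)$. For a primitive root $g\in\mathbb Z$ modulo $p$, the sequence $\{g^4\}_p,\{g^8\}_p,\dots,\{g^{p-1}\}_p$ is a permutation of the sequence $\{a_1^2\}_p,\dots,\{a_n^2\}_p$. Let $\tau_p(g)$ be this permutation, that is, the unique permutation of $\{1,\dots,n\}$ with $\{g^{4i}\}_p=\{a_{\tau_p(g)(i)}^2\}_p$ for all $i$, and let $\mathrm{sgn}(\tau_p(g))\in\{1,-1\}$ be its sign. Let $\chi_4(2)=1$ if $2$ is a fourth power modulo $p$, and $\chi_4(2)=-1$ otherwise. Let $$A_p=\prod_{\substack{0<x<p/2\\ x^{(p-1)/4}\equiv 1\,(\mathrm{mod}\,p)}}x,\qquad B_p=\prod_{\substack{0<x<p/2\\ x^{(p-1)/4}\equiv -1\,(\mathrm{mod}\,p)}}x,\qquad U_p=\prod_{1\le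 i<j\le n}\sin\frac{2\pi(a_j^2-a_i^2)}{p}.$$ Then $U_p\neq 0$; let $\lambda_p=0$ if $U_p>0$ and $\lambda_p=1$ if $U_p<0$. (i) Suppose $p\equiv 9\pmod{16}$. Then there are unique $\beta_p,\gamma_p\in\{0,1\}$ with $$(-1)^{\beta_p}\equiv A_p,\qquad (-1)^{\gamma_p}\equiv 2bB_p/a\pmod p.$$ The sign $\mathrm{sgn}(\tau_p(g))$ does not depend on the choice of the primitive root $g$, and $$\mathrm{sgn}(\tau_p(g))=\begin{cases}(-1)^{\lambda_p+\beta_p+\frac{3p+11-2a+8b}{32}}&\text{if }\chi_4(2)=1,\\[2pt](-1)^{\lambda_p+\gamma_p+\frac{3p-21-2a-8b}{32}}&\text{if }\chi_4(2)=-1.\end{cases}$$ (ii) Suppose $p\equiv 1\pmod{16}$. Then for every primitive root $g$ modulo $p$ there are unique $\delta_p(g),\mu_p(g)\in\{0,1\}$ with $$(-1)^{\delta_p(g)}\equiv A_p/g^{(p-1)/4},\qquad (-1)^{\mu_p(g)}\equiv 2bB_p/(a\,g^{(p-1)/4})\pmod p,$$ and $$\mathrm{sgn}(\tau_p(g))=\begin{cases}(-1)^{\lambda_p+\delta_p(g)+\frac{3p-5-2a+8b}{32}}&\text{if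 }\chi_4(2)=1,\\[2pt](-1)^{\lambda_p+\mu_p(g)+\frac{3p+27-2a-8b}{32}}&\text{if }\chi_4(2)=-1.\end{cases}$$ Moreover, with $\mathcal P=\{0<g<p: g\text{ is a primitive root modulo }p\}$, $$\#\{g\in\mathcal P:\mathrm{sgn}(\tau_p(g))=1\}=\#\{g\in\mathcal P:\mathrm{sgn}(\tau_p(g))=-1\}.$$ In each of the four cases the displayed fraction with denominator $32$ is an integer. -/

import Mathlib

namespace BiquadPerm

/-- The rational quartic residue symbol `χ₄(m) = (m/p)₄`. -/
noncomputable def chi4 (p : ℕ) (m : ℤ) : ℤ :=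
  open Classical in
  if (p : ℤ) ∣ m then 0 else if ∃ x : ℤ, x ^ 4 ≡ m [ZMOD p] then 1 else -1

/-- `x` is a quadratic residue modulo `p` lying in the open interval `(0, p/2)`. -/
def IsHalfResidue (p x : ℕ) : Prop :=
  0 < x ∧ 2 * x < p ∧ ∃ y : ℤ, y ^ 2 ≡ (x : ℤ) [ZMOD p]

/-- The quadratic residues in `(0, p/2)` in ascending order, indexed from `0`:
`halfResidue p i` is the residue usually written `a_{i+1}`. -/
noncomputable def halfResidue (p : ℕ) (i : ℕ) : ℕ := Nat.nth (IsHalfResidue p) i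

/-- The sequence `{a₁²}_p, …, {a_{(p-1)/4}²}_p` of least nonnegative residues. -/
noncomputable def squareSeq (p : ℕ) (i : Fin ((p - 1) / 4)) : ℤ :=
  ((halfResidue p i : ℤ) ^ 2) % (p : ℤ)

/-- The sequence `{g⁴}_p, {g⁸}_p, …, {g^{p-1}}_p` of least nonnegative residues. -/
def powerSeq (p : ℕ) (g : ℤ) (i : Fin ((p - 1) / 4)) : ℤ :=
  (g ^ (4 * ((i : ℕ) + 1))) % (p : ℤ)

/-- The permutation `π` of the positions turns `squareSeq p` into `powerSeq p g`. -/
def IsTau (p : ℕ) (g : ℤ) (π : Equiv.Perm (Fin ((p - 1) / 4))) : Prop :=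
  ∀ i, powerSeq p g i = squareSeq p (π i)

/-- The permutation `τ_p(g)` (the identity if there is no permutation as required). -/
noncomputable def tau (p : ℕ) (g : ℤ) : Equiv.Perm (Fin ((p - 1) / 4)) :=
  open Classical in
  if h : ∃ π, IsTau p g π then h.choose else 1

/-- `g` is a primitive root modulo `p` (for a prime `p`): its class has exact order `p - 1`. -/
def IsPrimRootMod (p : ℕ) (g : ℤ) : Prop := IsPrimitiveRoot (g : ZMod p) (p - 1)

/-- The set of `x` with `0 < x < p/2` and `x^{(p-1)/4} ≡ ε (mod p)`. -/
def Omega (p : ℕ) (ε : ZMod p) : Finset ℕ :=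
  (Finset.range p).filter fun x => 0 < x ∧ 2 * x < p ∧ (x : ZMod p) ^ ((p - 1) / 4) = ε

/-- `A_p`, the product of the elements of `Ω₁`. -/
def prodA (p : ℕ) : ℕ := ∏ t ∈ Omega p 1, t

/-- `B_p`, the product of the elements of `Ω₋₁`. -/
def prodB (p : ℕ) : ℕ := ∏ t ∈ Omega p (-1), t

/-- The `e ∈ {0, 1}` with `(-1)^e = x`, for `x = ±1`. -/
def signExp {p : ℕ} (x : ZMod p) : ℕ := if x = 1 then 0 else 1

/-- `β_p`. -/
def beta (p : ℕ) : ℕ := signExp (prodA p : ZMod p)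

/-- `δ_p(g)`. -/
def delta (p : ℕ) [Fact p.Prime] (g : ℤ) : ℕ :=
  signExp ((prodA p : ZMod p) / (g : ZMod p) ^ ((p - 1) / 4))

/-- `γ_p`, where `p = a² + 4b²`. -/
def gamma (p : ℕ) [Fact p.Prime] (a b : ℤ) : ℕ :=
  signExp (2 * (b : ZMod p) * (prodB p : ZMod p) / (a : ZMod p))

/-- `μ_p(g)`, where `p = a² + 4b²`. -/
def mu (p : ℕ) [Fact p.Prime] (a b g : ℤ) : ℕ :=
  signExp (2 * (b : ZMod p) * (prodB p : ZMod p) /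
    ((a : ZMod p) * (g : ZMod p) ^ ((p - 1) / 4)))

/-- `U_p`, the product of `sin (2π(a_j² - a_i²)/p)` over `i < j`. -/
noncomputable def sineProd (p : ℕ) : ℝ :=
  ∏ i : Fin ((p - 1) / 4), ∏ j ∈ Finset.Ioi i,
    Real.sin (2 * Real.pi * ((halfResidue p j : ℝ) ^ 2 - (halfResidue p i : ℝ) ^ 2) / (p : ℝ))

/-- `λ_p`: it is `0` if `U_p > 0` and `1` if `U_p < 0`. -/
noncomputable def lam (p : ℕ) : ℕ :=
  open Classical in
  if 0 < sineProd p then 0 else 1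

end BiquadPerm

open BiquadPerm

/-! ### Quartic classes, the quartic character and cyclotomic numbers -/

section Quartic

open Finset

variable {p : ℕ} [Fact p.Prime] {n : ℕ}

/-! Write `p = 4n + 1` and `n = 2h`. The squares `a_i ^ 2` list the subgroup of fourth powers, and
so do the powers of `g ^ 4`; hence the sign of `τ_p(g)` is the ratio in `ℤ/p` of two Vandermonde
products (`sign_tau_mul`).

The product for the powers of `g ^ 4` is a computation with roots of unity (`prod_sub_pow_sq`) and
gives `-ι * ι ^ h * n ^ h` with `ι = g ^ n`. In the product for the `a_i ^ 2` each difference is a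
sign times its representative in `(0, p/2)`. The signs are those of the sines and multiply to `(-1)
^ λ_p` (`sineProd_ne_zero_and_lam`). The number of ordered pairs of fourth powers with difference
`d` is a cyclotomic number depending only on `d ^ n` (`card_sub_eq_cyc`), so what remains is a
product of the four half-class products `halfProd n α`, each raised to the power `cyc n 1 α`
(`prod_sub_eq`).

A Wilson argument gives the squares of the half-class products (`halfProd_sq`), so only the
exponents modulo small powers of 2 matter. The exponents follow from the Jacobi sum `J(χ, χ²) = a +
2bi` of the quartic character: its norm is `p`, it vanishes under `i ↦ I = 2b/a`, and a congruence
modulo 4 fixes its sign (`cyc_values`). By Gauss's parity argument (`odd_cyc_one_one`), exactly one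
of `A_p` and `B_p` survives to an odd power, according to whether 2 is a fourth power; in the second
case a factor `I` also survives.

When `h` is even the Vandermonde product of the powers is odd in `ι`, and `g ↦ g⁻¹` replaces `ι` by
`-ι`; this gives the equal distribution of signs. -/

theorem zmod_two_ne_zero (hp : p = 4 * n + 1) : (2 : ZMod p) ≠ 0 := by
  intro h
  have h2 : ((2 : ℕ) : ZMod p) = 0 := by exact_mod_cast h
  rw [ZMod.natCast_eq_zero_iff] at h2
  have := Nat.le_of_dvd (by norm_num) h2
  have := (Fact.out : p.Prime).two_le
  omega

theorem pos_of_prime_eq (hp : p = 4 * n + 1) : 0 < n := by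
  have := (Fact.out : p.Prime).two_le
  omega

theorem pow_eq_one_or (hp : p = 4 * n + 1) {I : ZMod p} (hI : I ^ 2 = -1) {x : ZMod p}
    (hx : x ≠ 0) : x ^ n = 1 ∨ x ^ n = -1 ∨ x ^ n = I ∨ x ^ n = -I := by
  have h : x ^ (p - 1) = 1 := ZMod.pow_card_sub_one_eq_one hx
  rw [show p - 1 = n * 4 by omega, pow_mul] at h
  have h' : (x ^ n - 1) * (x ^ n + 1) * ((x ^ n - I) * (x ^ n + I)) = 0 := by
    linear_combination h + (-(x ^ n) ^ 2 + 1) * hI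
  rcases mul_eq_zero.1 h' with h | h <;> rcases mul_eq_zero.1 h with h | h
  · exact Or.inl (sub_eq_zero.1 h)
  · exact Or.inr (Or.inl (eq_neg_of_add_eq_zero_left h))
  · exact Or.inr (Or.inr (Or.inl (sub_eq_zero.1 h)))
  · exact Or.inr (Or.inr (Or.inr (eq_neg_of_add_eq_zero_left h)))

/-- The distinctness of the fourth roots of unity. -/
theorem fourth_roots_ne (hp : p = 4 * n + 1) {I : ZMod p} (hI : I ^ 2 = -1) :
    (1 : ZMod p) ≠ -1 ∧ (1 : ZMod p) ≠ I ∧ (1 : ZMod p) ≠ -I ∧ (-1 : ZMod p) ≠ I ∧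
      I ≠ -I ∧ I ≠ 0 := by
  have h2 := zmod_two_ne_zero hp
  have h1 : (1 : ZMod p) ≠ -1 := fun h => h2 (by linear_combination h)
  have h0 : I ≠ 0 := by rintro rfl; simp at hI
  refine ⟨h1, ?_, ?_, ?_, ?_, h0⟩
  · rintro h; apply h1; rw [← hI, ← h]; ring
  · intro h; apply h1; rw [← hI, show I = -1 by linear_combination h]; ring
  · intro h; apply h1; rw [← hI, ← h]; ring
  · intro h; exact (mul_ne_zero h2 h0) (by linear_combination h)

/-- The indicator of the class `x ^ n = α`. -/
def powInd (n : ℕ) (α x : ZMod p) : ℤ := if x ^ n = α then 1 else 0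

theorem powInd_zero (hn : 0 < n) {α : ZMod p} (hα : α ≠ 0) : powInd n α 0 = 0 := by
  rw [powInd, zero_pow hn.ne', if_neg hα.symm]

/-- The quartic character with `x ^ n ↦ ` the Gaussian unit corresponding to it under `I ↦ i`. -/
def quarticChar (hp : p = 4 * n + 1) {I : ZMod p} (hI : I ^ 2 = -1) :
    MulChar (ZMod p) GaussianInt where
  toFun x := ⟨powInd n 1 x - powInd n (-1) x, powInd n I x - powInd n (-I) x⟩
  map_one' := by
    obtain ⟨h1, h2, h3, h4, h5, h6⟩ := fourth_roots_ne hp hI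
    simp [powInd, h1, h2, h3, Zsqrtd.ext_iff]
  map_mul' x y := by
    obtain ⟨h1, h2, h3, h4, h5, h6⟩ := fourth_roots_ne hp hI
    have hn := pos_of_prime_eq hp
    have h7 : (-1 : ZMod p) ≠ 0 := by simp
    have h8 : -I ≠ 0 := by simpa using h6
    have h9 : (-1 : ZMod p) ≠ -I := fun h => h2 (neg_injective h)
    have hI' : I * I = -1 := by rw [← hI]; ring
    rcases eq_or_ne x 0 with rfl | hx
    · simp [powInd_zero hn, h6, Zsqrtd.ext_iff]
    rcases eq_or_ne y 0 with rfl | hy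
    · simp [powInd_zero hn, h6, Zsqrtd.ext_iff]
    rcases pow_eq_one_or hp hI hx with hx | hx | hx | hx <;>
    rcases pow_eq_one_or hp hI hy with hy | hy | hy | hy <;>
    simp [powInd, mul_pow, hx, hy, h1, h2, h3, h4, h5, h9, h1.symm, h2.symm, h3.symm, h4.symm,
      h5.symm, h9.symm, hI', Zsqrtd.ext_iff, -one_pow]
  map_nonunit' x hx := by
    have : x = 0 := by simpa using hx
    subst this
    obtain ⟨-, -, -, -, -, h6⟩ := fourth_roots_ne hp hI
    simp [powInd_zero (pos_of_prime_eq hp), h6, Zsqrtd.ext_iff]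

theorem quarticChar_apply (hp : p = 4 * n + 1) {I : ZMod p} (hI : I ^ 2 = -1) (x : ZMod p) :
    quarticChar hp hI x =
      ⟨powInd n 1 x - powInd n (-1) x, powInd n I x - powInd n (-I) x⟩ := rfl

/-- The ring homomorphism `ℤ[i] → ℤ/p` with `i ↦ I`. -/
def gaussReduce {I : ZMod p} (hI : I ^ 2 = -1) : GaussianInt →+* ZMod p :=
  Zsqrtd.lift ⟨I, by rw [← sq, hI]; simp⟩

theorem gaussReduce_apply {I : ZMod p} (hI : I ^ 2 = -1) (z : GaussianInt) :
    gaussReduce hI z = z.re + z.im * I := rfl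

theorem gaussReduce_quarticChar (hp : p = 4 * n + 1) {I : ZMod p} (hI : I ^ 2 = -1)
    (x : ZMod p) : gaussReduce hI (quarticChar hp hI x) = x ^ n := by
  obtain ⟨h1, h2, h3, h4, h5, h6⟩ := fourth_roots_ne hp hI
  have h9 : (-1 : ZMod p) ≠ -I := fun h => h2 (neg_injective h)
  rw [gaussReduce_apply, quarticChar_apply]
  rcases eq_or_ne x 0 with rfl | hx
  · simp [powInd_zero (pos_of_prime_eq hp), h6, (pos_of_prime_eq hp).ne']
  rcases pow_eq_one_or hp hI hx with hx | hx | hx | hx <;>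
  simp [powInd, hx, h1, h2, h3, h4, h5, h9, h1.symm, h2.symm, h3.symm, h4.symm,
      h5.symm, h9.symm]

/-- The cyclotomic number counting `x` with `x ^ n = α` and `(1 - x) ^ n = β`. -/
def cyc (n : ℕ) (α β : ZMod p) : ℕ :=
  #{x : ZMod p | x ^ n = α ∧ (1 - x) ^ n = β}

theorem cyc_eq_sum (α β : ZMod p) :
    (cyc n α β : ℤ) = ∑ x : ZMod p, powInd n α x * powInd n β (1 - x) := by
  rw [cyc, Finset.card_filter]
  push_cast
  refine Finset.sum_congr rfl fun x _ => ?_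
  by_cases h1 : x ^ n = α <;> by_cases h2 : (1 - x) ^ n = β <;> simp [powInd, h1, h2]

theorem cyc_comm (α β : ZMod p) : cyc n α β = cyc n β α := by
  refine Finset.card_bij' (fun x _ => 1 - x) (fun x _ => 1 - x) ?_ ?_ ?_ ?_ <;>
    simp +contextual

/-- The substitution `x ↦ x⁻¹`, with `1 - x⁻¹ = -(1 - x) / x`; the minus sign disappears because `n`
is even. -/
theorem cyc_inv (hn : Even n) (hn0 : 0 < n) {α β : ZMod p} (hα : α ≠ 0) :
    cyc n α β = cyc n α⁻¹ (β * α⁻¹) := by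
  refine Finset.card_bij' (fun x _ => x⁻¹) (fun x _ => x⁻¹) ?_ ?_ (by simp) (by simp)
  · intro x hx
    simp only [Finset.mem_filter, Finset.mem_univ, true_and] at hx ⊢
    have hx0 : x ≠ 0 := by rintro rfl; exact hα (by rw [← hx.1, zero_pow hn0.ne'])
    refine ⟨by rw [inv_pow, hx.1], ?_⟩
    rw [show 1 - x⁻¹ = -((1 - x) * x⁻¹) by field_simp; ring, hn.neg_pow, mul_pow, inv_pow,
      hx.1, hx.2]
  · intro x hx
    simp only [Finset.mem_filter, Finset.mem_univ, true_and] at hx ⊢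
    have hx0 : x ≠ 0 := by
      rintro rfl; exact inv_ne_zero hα (by rw [← hx.1, zero_pow hn0.ne'])
    refine ⟨by rw [inv_pow, hx.1, inv_inv], ?_⟩
    rw [show 1 - x⁻¹ = -((1 - x) * x⁻¹) by field_simp; ring, hn.neg_pow, mul_pow, inv_pow,
      hx.1, hx.2, inv_inv]
    field_simp

end Quartic

/-! ### Sizes, products and cyclotomic relations of the quartic classes -/

section PowerClasses

open Finset

variable {p : ℕ} [Fact p.Prime] {n : ℕ}

theorem card_pow_eq_le (hn : 0 < n) (α : ZMod p) : #{x : ZMod p | x ^ n = α} ≤ n := by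
  refine le_trans ?_ (Polynomial.card_nthRoots n α)
  refine le_trans (Finset.card_le_card ?_) (Multiset.toFinset_card_le _)
  intro x hx
  simpa [Polynomial.mem_nthRoots hn] using hx

theorem sum_powInd (hp : p = 4 * n + 1) {I : ZMod p} (hI : I ^ 2 = -1) (x : ZMod p) :
    powInd n 1 x + powInd n (-1) x + powInd n I x + powInd n (-I) x =
      1 - if x = 0 then 1 else 0 := by
  obtain ⟨h1, h2, h3, h4, h5, h6⟩ := fourth_roots_ne hp hI
  have h9 : (-1 : ZMod p) ≠ -I := fun h => h2 (neg_injective h)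
  rcases eq_or_ne x 0 with rfl | hx
  · simp [powInd_zero (pos_of_prime_eq hp), h6]
  rcases pow_eq_one_or hp hI hx with h | h | h | h <;>
  simp [powInd, h, hx, h1, h2, h3, h4, h5, h9, h1.symm, h2.symm, h3.symm, h4.symm,
      h5.symm, h9.symm]

theorem card_pow_eq_sum (α : ZMod p) :
    (#{x : ZMod p | x ^ n = α} : ℤ) = ∑ x : ZMod p, powInd n α x := by
  rw [Finset.card_filter]
  push_cast
  rfl

/-- Each class has at most `n` elements, being a set of roots of a polynomial of degree `n`; the
four classes together fill all `4n` units, so every bound is attained. -/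
theorem card_pow_eq_aux (hp : p = 4 * n + 1) {I : ZMod p} (hI : I ^ 2 = -1) :
    #{x : ZMod p | x ^ n = 1} = n ∧ #{x : ZMod p | x ^ n = -1} = n ∧
      #{x : ZMod p | x ^ n = I} = n ∧ #{x : ZMod p | x ^ n = -I} = n := by
  have hn := pos_of_prime_eq hp
  have key : (#{x : ZMod p | x ^ n = 1} : ℤ) + #{x : ZMod p | x ^ n = -1} +
      #{x : ZMod p | x ^ n = I} + #{x : ZMod p | x ^ n = -I} = 4 * n := by
    simp only [card_pow_eq_sum, ← Finset.sum_add_distrib, sum_powInd hp hI]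
    simp only [Finset.sum_sub_distrib, Finset.sum_const, Finset.card_univ, ZMod.card,
      Finset.sum_ite_eq', Finset.mem_univ, if_true]
    rw [hp]; ring
  have h1 := card_pow_eq_le hn (1 : ZMod p)
  have h2 := card_pow_eq_le hn (-1 : ZMod p)
  have h3 := card_pow_eq_le hn I
  have h4 := card_pow_eq_le hn (-I)
  omega

theorem card_pow_eq (hp : p = 4 * n + 1) {I : ZMod p} (hI : I ^ 2 = -1) {α : ZMod p}
    (hα : α = 1 ∨ α = -1 ∨ α = I ∨ α = -I) : #{x : ZMod p | x ^ n = α} = n := by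
  obtain ⟨h1, h2, h3, h4⟩ := card_pow_eq_aux hp hI
  rcases hα with rfl | rfl | rfl | rfl <;> assumption

-- A Wilson-type identity: the class is the full root set of `X ^ n - α`, so its product is read off
-- from the constant term, `n` being even.
open Polynomial in
theorem prod_pow_eq (hp : p = 4 * n + 1) (hn : Even n) {I : ZMod p} (hI : I ^ 2 = -1)
    {α : ZMod p} (hα : α = 1 ∨ α = -1 ∨ α = I ∨ α = -I) :
    ∏ x : ZMod p with x ^ n = α, x = -α := by
  have hn0 := pos_of_prime_eq hp
  have hc := card_pow_eq hp hI hα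
  set s : Finset (ZMod p) := {x : ZMod p | x ^ n = α} with hs
  have hle : s.val ≤ (X ^ n - C α : (ZMod p)[X]).roots := by
    rw [Multiset.le_iff_subset s.nodup]
    intro x hx
    have hx' : x ∈ s := hx
    have := mem_nthRoots hn0 (a := α) (x := x)
    rw [nthRoots] at this
    rw [this]
    simpa [hs] using hx'
  have hmon : (X ^ n - C α : (ZMod p)[X]).Monic := monic_X_pow_sub_C α hn0.ne'
  have hdeg : (X ^ n - C α : (ZMod p)[X]).natDegree = n := natDegree_X_pow_sub_C
  have heq : s.val = (X ^ n - C α : (ZMod p)[X]).roots := by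
    refine Multiset.eq_of_le_of_card_le hle ?_
    refine (card_roots' _).trans ?_
    rw [hdeg]; exact hc.ge
  have hprod := prod_multiset_X_sub_C_of_monic_of_roots_card_eq hmon
    (by rw [hdeg, ← heq]; exact hc)
  rw [← heq] at hprod
  have h0 := congrArg (eval 0) hprod
  change eval 0 (∏ x ∈ s, (X - C x)) = _ at h0
  rw [eval_prod] at h0
  simp only [eval_sub, eval_X, eval_C, zero_sub, eval_pow, zero_pow hn0.ne'] at h0
  rw [Finset.prod_neg, hc, hn.neg_one_pow, one_mul] at h0
  exact h0

theorem sum_cyc (hp : p = 4 * n + 1) {I : ZMod p} (hI : I ^ 2 = -1) {α : ZMod p}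
    (hα : α = 1 ∨ α = -1 ∨ α = I ∨ α = -I) :
    (cyc n α 1 : ℤ) + cyc n α (-1) + cyc n α I + cyc n α (-I) = n - if α = 1 then 1 else 0 := by
  simp only [cyc_eq_sum, ← Finset.sum_add_distrib, ← mul_add, sum_powInd hp hI]
  simp only [mul_sub, mul_one, Finset.sum_sub_distrib, ← card_pow_eq_sum, card_pow_eq hp hI hα]
  have : ∀ x : ZMod p, (1 - x = 0) ↔ x = 1 := fun x => by rw [sub_eq_zero, eq_comm]
  simp [this, powInd, eq_comm]

/-- The relations between the quartic cyclotomic numbers. -/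
theorem cyc_relations (hp : p = 4 * n + 1) (hn : Even n) {I : ZMod p} (hI : I ^ 2 = -1) :
    cyc (p := p) n (-1) 1 = cyc (p := p) n 1 (-1) ∧ cyc (p := p) n (-1) (-1) = cyc (p := p) n 1 (-1) ∧
    cyc n I 1 = cyc (p := p) n 1 I ∧ cyc (p := p) n (-I) 1 = cyc (p := p) n 1 (-I) ∧
    cyc n I I = cyc (p := p) n 1 (-I) ∧ cyc (p := p) n (-I) (-I) = cyc (p := p) n 1 I ∧
    cyc (p := p) n (-1) (-I) = cyc (p := p) n (-1) I ∧ cyc n I (-1) = cyc (p := p) n (-1) I ∧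
    cyc (p := p) n (-I) (-1) = cyc (p := p) n (-1) I ∧ cyc n I (-I) = cyc (p := p) n (-1) I ∧
    cyc (p := p) n (-I) I = cyc (p := p) n (-1) I := by
  obtain ⟨h1, h2, h3, h4, h5, h6⟩ := fourth_roots_ne hp hI
  have hn0 := pos_of_prime_eq hp
  have hI' : I * I = -1 := by rw [← hI]; ring
  have hinv : I⁻¹ = -I := inv_eq_of_mul_eq_one_right (by rw [mul_neg, hI', neg_neg])
  have hinv2 : (-1 : ZMod p)⁻¹ = -1 := by rw [inv_neg, inv_one]
  have hinv3 : (-I)⁻¹ = I := by rw [inv_neg, hinv, neg_neg]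
  -- The substitutions `x ↦ 1 - x` and `x ↦ x⁻¹` collapse the sixteen numbers to five, represented
  -- by the pairs `(1, 1)`, `(1, -1)`, `(1, I)`, `(1, -I)` and `(-1, I)`.
  have e1 := cyc_inv (β := -1) hn hn0 (neg_ne_zero.2 (one_ne_zero (α := ZMod p)))
  have e2 := cyc_inv (β := I) hn hn0 h6
  have e3 := cyc_inv (β := -I) hn hn0 (neg_ne_zero.2 h6)
  have e4 := cyc_inv (β := -I) hn hn0 (neg_ne_zero.2 (one_ne_zero (α := ZMod p)))
  have e5 := cyc_inv (β := -I) hn hn0 h6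
  simp only [hinv, hinv2, hinv3, mul_neg, neg_mul, neg_neg, mul_one, hI'] at e1 e2 e3 e4 e5
  have c1 := cyc_comm (n := n) (-1 : ZMod p) 1
  have c2 := cyc_comm (n := n) (-1 : ZMod p) I
  have c3 := cyc_comm (n := n) (-1 : ZMod p) (-I)
  have c4 := cyc_comm (n := n) 1 I
  have c5 := cyc_comm (n := n) 1 (-I)
  have c6 := cyc_comm (n := n) I (-I)
  omega

theorem sum_eval_eq_zero_of_natDegree_lt (f : Polynomial (ZMod p)) (hf : f.natDegree < p - 1) :
    ∑ x : ZMod p, f.eval x = 0 := by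
  simp only [Polynomial.eval_eq_sum_range]
  rw [Finset.sum_comm]
  refine Finset.sum_eq_zero fun i hi => ?_
  rw [← Finset.mul_sum, FiniteField.sum_pow_lt_card_sub_one, mul_zero]
  rw [ZMod.card]
  exact (Nat.lt_succ_iff.1 (Finset.mem_range.1 hi)).trans_lt hf

end PowerClasses

/-! ### The Jacobi sum of the quartic character and the values of the cyclotomic numbers -/

section JacobiSum

open Finset

variable {p : ℕ} [Fact p.Prime] {n : ℕ}

theorem quarticChar_sq_apply (hp : p = 4 * n + 1) {I : ZMod p} (hI : I ^ 2 = -1) (x : ZMod p) :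
    (quarticChar hp hI * quarticChar hp hI) x =
      ⟨powInd n 1 x + powInd n (-1) x - powInd n I x - powInd n (-I) x, 0⟩ := by
  obtain ⟨h1, h2, h3, h4, h5, h6⟩ := fourth_roots_ne hp hI
  have h9 : (-1 : ZMod p) ≠ -I := fun h => h2 (neg_injective h)
  rw [MulChar.mul_apply, quarticChar_apply]
  rcases eq_or_ne x 0 with rfl | hx
  · simp [powInd_zero (pos_of_prime_eq hp), h6, Zsqrtd.ext_iff]
  rcases pow_eq_one_or hp hI hx with hx | hx | hx | hx <;>
  simp [powInd, hx, h1, h2, h3, h4, h5, h9, h1.symm, h2.symm, h3.symm, h4.symm,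
      h5.symm, h9.symm, Zsqrtd.ext_iff]

theorem quarticChar_inv (hp : p = 4 * n + 1) {I : ZMod p} (hI : I ^ 2 = -1) :
    (quarticChar hp hI)⁻¹ = (quarticChar hp hI).ringHomComp (starRingEnd GaussianInt) := by
  obtain ⟨h1, h2, h3, h4, h5, h6⟩ := fourth_roots_ne hp hI
  have h9 : (-1 : ZMod p) ≠ -I := fun h => h2 (neg_injective h)
  symm
  apply eq_inv_of_mul_eq_one_right
  refine MulChar.ext fun u => ?_
  rw [MulChar.mul_apply, MulChar.ringHomComp_apply, MulChar.one_apply_coe, quarticChar_apply]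
  rcases pow_eq_one_or hp hI u.ne_zero with hx | hx | hx | hx <;>
  simp [powInd, hx, h1, h2, h3, h4, h5, h9, h1.symm, h2.symm, h3.symm, h4.symm,
      h5.symm, h9.symm, Zsqrtd.ext_iff, starRingEnd_apply, -Units.val_pow_eq_pow_val]

/-- An `x` with `χ x = i` shows that `χ`, `χ²` and `χ³` are all nontrivial. The general identity for
`J(χ, φ) * J(χ⁻¹, φ⁻¹)` is applied over `ℂ`, where inversion of these characters is complex
conjugation, and pulled back along the injection of `ℤ[i]`. -/
theorem norm_jacobiSum_quarticChar (hp : p = 4 * n + 1) {I : ZMod p} (hI : I ^ 2 = -1) :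
    (jacobiSum (quarticChar hp hI) (quarticChar hp hI * quarticChar hp hI)).norm = p := by
  obtain ⟨h1, h2, h3, h4, h5, h6⟩ := fourth_roots_ne hp hI
  set χ := quarticChar hp hI with hχ
  obtain ⟨x, hx⟩ : ∃ x : ZMod p, x ^ n = I := by
    have h := (card_pow_eq_aux hp hI).2.2.1
    have hpos : 0 < #{x : ZMod p | x ^ n = I} := by
      rw [h]; exact pos_of_prime_eq hp
    obtain ⟨x, hx⟩ := Finset.card_pos.1 hpos
    exact ⟨x, by simpa using hx⟩
  have hx0 : x ≠ 0 := by rintro rfl; rw [zero_pow (pos_of_prime_eq hp).ne'] at hx; exact h6 hx.symm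
  have hχx : χ x = ⟨0, 1⟩ := by
    rw [hχ, quarticChar_apply]
    simp [powInd, hx, h2.symm, h4.symm, h5]
  have hone : (1 : MulChar (ZMod p) GaussianInt) x = 1 :=
    MulChar.one_apply_coe (Units.mk0 x hx0)
  have n1 : χ ≠ 1 := fun h => by
    rw [h, hone] at hχx; simp [Zsqrtd.ext_iff] at hχx
  have n2 : χ * χ ≠ 1 := fun h => by
    have := DFunLike.congr_fun h x
    rw [MulChar.mul_apply, hχx, hone] at this
    simp [Zsqrtd.ext_iff] at this
  have n3 : χ * (χ * χ) ≠ 1 := fun h => by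
    have := DFunLike.congr_fun h x
    rw [MulChar.mul_apply, MulChar.mul_apply, hχx, hone] at this
    simp [Zsqrtd.ext_iff] at this
  have hinj := GaussianInt.toComplex_injective
  have key := jacobiSum_mul_jacobiSum_inv (F := ZMod p) (F' := ℂ)
    (χ := χ.ringHomComp GaussianInt.toComplex) (φ := (χ * χ).ringHomComp GaussianInt.toComplex)
    (by rw [ringChar.eq ℂ 0, ZMod.ringChar_zmod_n]; exact (Fact.out : p.Prime).ne_zero.symm)
    ((MulChar.ringHomComp_ne_one_iff hinj).2 n1) ((MulChar.ringHomComp_ne_one_iff hinj).2 n2)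
    (by rw [← MulChar.ringHomComp_mul]; exact (MulChar.ringHomComp_ne_one_iff hinj).2 n3)
  rw [MulChar.ringHomComp_inv, MulChar.ringHomComp_inv, mul_inv, hχ, quarticChar_inv,
    ← MulChar.ringHomComp_mul, jacobiSum_ringHomComp, jacobiSum_ringHomComp,
    jacobiSum_ringHomComp, ← map_mul, ZMod.card] at key
  have h' : jacobiSum χ (χ * χ) * starRingEnd _ (jacobiSum χ (χ * χ)) = (p : GaussianInt) :=
    hinj (by rw [key]; simp)
  have h'' := Zsqrtd.norm_eq_mul_conj (jacobiSum χ (χ * χ))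
  rw [starRingEnd_apply] at h'
  rw [h'] at h''
  exact_mod_cast h''

theorem jacobiSum_quarticChar_re (hp : p = 4 * n + 1) {I : ZMod p} (hI : I ^ 2 = -1) :
    (jacobiSum (quarticChar hp hI) (quarticChar hp hI * quarticChar hp hI)).re =
      cyc (p := p) n 1 1 + cyc (p := p) n 1 (-1) - cyc (p := p) n 1 I - cyc (p := p) n 1 (-I)
      - (cyc (p := p) n (-1) 1 + cyc (p := p) n (-1) (-1) - cyc (p := p) n (-1) I
        - cyc (p := p) n (-1) (-I)) := by
  have hre : ∀ f : ZMod p → GaussianInt, (∑ x, f x).re = ∑ x, (f x).re := fun f =>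
    map_sum (⟨⟨Zsqrtd.re, rfl⟩, fun _ _ => rfl⟩ : GaussianInt →+ ℤ) f univ
  simp only [jacobiSum, hre, quarticChar_sq_apply]
  simp only [quarticChar_apply, Zsqrtd.re_mul, cyc_eq_sum, ← Finset.sum_add_distrib,
    ← Finset.sum_sub_distrib]
  exact Finset.sum_congr rfl fun x _ => by ring

theorem jacobiSum_quarticChar_im (hp : p = 4 * n + 1) {I : ZMod p} (hI : I ^ 2 = -1) :
    (jacobiSum (quarticChar hp hI) (quarticChar hp hI * quarticChar hp hI)).im =
      cyc (p := p) n I 1 + cyc (p := p) n I (-1) - cyc (p := p) n I I - cyc (p := p) n I (-I)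
      - (cyc (p := p) n (-I) 1 + cyc (p := p) n (-I) (-1) - cyc (p := p) n (-I) I
        - cyc (p := p) n (-I) (-I)) := by
  have him : ∀ f : ZMod p → GaussianInt, (∑ x, f x).im = ∑ x, (f x).im := fun f =>
    map_sum (⟨⟨Zsqrtd.im, rfl⟩, fun _ _ => rfl⟩ : GaussianInt →+ ℤ) f univ
  simp only [jacobiSum, him, quarticChar_sq_apply]
  simp only [quarticChar_apply, Zsqrtd.im_mul, cyc_eq_sum, ← Finset.sum_add_distrib,
    ← Finset.sum_sub_distrib]
  exact Finset.sum_congr rfl fun x _ => by ring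

/-- Under `i ↦ I` the sum becomes `∑ x ^ n * (1 - x) ^ (2n)`, whose summand has degree at most `3n <
p - 1`, so every power sum in it vanishes. This distinguishes the Jacobi sum from its conjugate, and
hence fixes the sign of `b`. -/
theorem gaussReduce_jacobiSum (hp : p = 4 * n + 1) {I : ZMod p} (hI : I ^ 2 = -1) :
    gaussReduce hI (jacobiSum (quarticChar hp hI) (quarticChar hp hI * quarticChar hp hI)) = 0 := by
  simp only [jacobiSum, map_sum, map_mul, MulChar.mul_apply, gaussReduce_quarticChar]
  have hdeg : ((Polynomial.X : Polynomial (ZMod p)) ^ n *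
      ((1 - Polynomial.X) ^ n * (1 - Polynomial.X) ^ n)).natDegree < p - 1 := by
    have hn := pos_of_prime_eq hp
    have : ((Polynomial.X : Polynomial (ZMod p)) ^ n *
      ((1 - Polynomial.X) ^ n * (1 - Polynomial.X) ^ n)).natDegree ≤ n * 1 + (n * 1 + n * 1) := by
      compute_degree
      omega
    omega
  simpa using sum_eval_eq_zero_of_natDegree_lt _ hdeg

/-- Two representations `q = a² + 4b² = s² + 4t²` with `q ∣ at - bs` agree up to sign. -/
theorem eq_or_eq_neg_of_sq_add_four_mul_sq {q a b s t : ℤ} (hq : q ≠ 0)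
    (hab : q = a ^ 2 + 4 * b ^ 2) (hst : q = s ^ 2 + 4 * t ^ 2) (hdvd : q ∣ a * t - b * s) :
    (s = a ∧ t = b) ∨ (s = -a ∧ t = -b) := by
  have hid : q ^ 2 = (a * s + 4 * b * t) ^ 2 + 4 * (a * t - b * s) ^ 2 := by
    rw [sq]; nth_rw 1 [hab]; rw [hst]; ring
  have h0 : a * t - b * s = 0 := by
    obtain ⟨k, hk⟩ := hdvd
    rw [hk] at hid ⊢
    have hqq : 0 < q ^ 2 := by positivity
    -- In the Brahmagupta identity `hid` the second square is `4 * q ^ 2 * k ^ 2`, too large for `q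
    -- ^ 2` unless `k = 0`.
    have h1 : 0 ≤ q ^ 2 * (1 - 4 * k ^ 2) := by
      rw [show q ^ 2 * (1 - 4 * k ^ 2) = (a * s + 4 * b * t) ^ 2 by linear_combination hid]
      exact sq_nonneg _
    have h2 := (mul_nonneg_iff_of_pos_left hqq).1 h1
    have hk0 : k ^ 2 = 0 := by have := sq_nonneg k; omega
    rw [pow_eq_zero_iff two_ne_zero] at hk0
    simp [hk0]
  rw [h0] at hid
  have hcase : a * s + 4 * b * t = q ∨ a * s + 4 * b * t = -q :=
    sq_eq_sq_iff_eq_or_eq_neg.1 (by linear_combination -hid)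
  have e1 : q * s = a * (a * s + 4 * b * t) := by
    rw [hab]; linear_combination (-4 * b) * h0
  have e2 : q * t = b * (a * s + 4 * b * t) := by
    rw [hab]; linear_combination a * h0
  rcases hcase with hc | hc <;> rw [hc] at e1 e2
  · exact Or.inl ⟨mul_left_cancel₀ hq (by linear_combination e1),
      mul_left_cancel₀ hq (by linear_combination e2)⟩
  · exact Or.inr ⟨mul_left_cancel₀ hq (by linear_combination e1),
      mul_left_cancel₀ hq (by linear_combination e2)⟩

/-- The quartic cyclotomic numbers `(0, k)` for a prime `p = a² + 4b² ≡ 1 (mod 8)`. -/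
theorem cyc_values (hp : p = 4 * n + 1) (hn : Even n) {I : ZMod p} (hI : I ^ 2 = -1) {a b : ℤ}
    (hab : (p : ℤ) = a ^ 2 + 4 * b ^ 2) (ha : a ≡ -1 [ZMOD 4])
    (hIab : (a : ZMod p) + 2 * b * I = 0) :
    16 * (cyc (p := p) n 1 (-1) : ℤ) = p - 3 - 2 * a ∧
    2 * (cyc (p := p) n 1 I : ℤ) = 2 * cyc (p := p) n 1 (-1) + b ∧
    2 * (cyc (p := p) n 1 (-I) : ℤ) = 2 * cyc (p := p) n 1 (-1) - b ∧
    (cyc (p := p) n 1 1 : ℤ) = n - 1 - 3 * cyc (p := p) n 1 (-1) := by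
  obtain ⟨h1, h2, h3, h4, h5, h6⟩ := fourth_roots_ne hp hI
  obtain ⟨r1, r2, r3, r4, r5, r6, r7, r8, r9, r10, r11⟩ := cyc_relations hp hn hI
  have s1 := sum_cyc hp hI (α := 1) (by simp)
  have s2 := sum_cyc hp hI (α := -1) (by simp)
  have s3 := sum_cyc hp hI (α := I) (by simp)
  rw [if_pos rfl] at s1
  rw [if_neg h1.symm] at s2
  rw [if_neg h2.symm] at s3
  have jre := jacobiSum_quarticChar_re hp hI
  have jim := jacobiSum_quarticChar_im hp hI
  have jn := norm_jacobiSum_quarticChar hp hI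
  have jr := gaussReduce_jacobiSum hp hI
  rw [gaussReduce_apply] at jr
  rw [Zsqrtd.norm_def] at jn
  set J := jacobiSum (quarticChar hp hI) (quarticChar hp hI * quarticChar hp hI)
  set t : ℤ := cyc (p := p) n 1 I - cyc (p := p) n 1 (-I) with ht
  set s : ℤ := J.re with hs
  have him : J.im = 2 * t := by
    rw [jim, r3, r4, r5, r6, r8, r9, r10, r11]; ring
  rw [r1, r2, r7] at jre
  have hsC : 8 * (cyc (p := p) n 1 (-1) : ℤ) = 2 * n - 1 - s := by omega
  rw [him] at jn jr
  have hst : (p : ℤ) = s ^ 2 + 4 * t ^ 2 := by rw [← jn]; ring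
  have hdvd : (p : ℤ) ∣ a * t - b * s := by
    rw [← ZMod.intCast_zmod_eq_zero_iff_dvd]
    have hI0 : (2 : ZMod p) * I ≠ 0 := mul_ne_zero (zmod_two_ne_zero hp) h6
    apply (mul_eq_zero.1 (_ : (2 * I) * _ = 0)).resolve_left hI0
    push_cast at jr ⊢
    linear_combination (a : ZMod p) * jr - (s : ZMod p) * hIab
  have hsa : s = a ∧ t = b := by
    rcases eq_or_eq_neg_of_sq_add_four_mul_sq (by exact_mod_cast (Fact.out : p.Prime).ne_zero) hab hst hdvd with h | h
    · exact h
    -- The opposite sign is impossible: `hsC` with `n` even gives `s ≡ -1 (mod 4)`, while `-a ≡ 1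
    -- (mod 4)`.
    · obtain ⟨m, hm⟩ := hn
      rw [Int.ModEq] at ha
      omega
  obtain ⟨hsa, htb⟩ := hsa
  have hpn : (p : ℤ) = 4 * n + 1 := by exact_mod_cast hp
  refine ⟨by omega, by omega, by omega, by omega⟩

/-- Gauss: the parity of the cyclotomic number `(0, 0)` detects the quartic character of `2`. -/
theorem odd_cyc_one_one (hp : p = 4 * n + 1) (hn : Even n) :
    Odd (cyc (p := p) n 1 1) ↔ (2 : ZMod p) ^ n = 1 := by
  have hn0 := pos_of_prime_eq hp
  set s : Finset (ZMod p) := {x : ZMod p | x ^ n = 1 ∧ (1 - x) ^ n = 1} with hs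
  have hmem : ∀ x, x ∈ s ↔ x ^ n = 1 ∧ (1 - x) ^ n = 1 := by simp [hs]
  have h2 := zmod_two_ne_zero hp
  have hinv : ∀ x ∈ s, x⁻¹ ∈ s := by
    intro x hx
    rw [hmem] at hx ⊢
    have hx0 : x ≠ 0 := by rintro rfl; simp [hn0.ne'] at hx
    refine ⟨by rw [inv_pow, hx.1, inv_one], ?_⟩
    rw [show 1 - x⁻¹ = -((1 - x) * x⁻¹) by field_simp; ring, hn.neg_pow, mul_pow, inv_pow,
      hx.1, hx.2, inv_one, mul_one]
  -- Inversion acts on `s`; its only possible fixed points are `±1`, and `1` is not in `s` because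
  -- `1 - 1 = 0`. So the parity is decided by whether `-1` lies in `s`, that is, whether `2 ^ n =
  -- 1`.
  have hpar : (∑ x ∈ s.erase (-1), (1 : ZMod 2)) = 0 := by
    refine Finset.sum_involution (fun x _ => x⁻¹) (fun x _ => by decide) ?_ ?_ (by simp)
    · intro x hx _ hxx
      obtain ⟨hx1, hx⟩ := Finset.mem_erase.1 hx
      have hx' := (hmem x).1 hx
      have hx0 : x ≠ 0 := by rintro rfl; simp [hn0.ne'] at hx'
      have hsq : x * x = 1 := by nth_rw 1 [← hxx]; exact inv_mul_cancel₀ hx0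
      rcases mul_self_eq_one_iff.1 hsq with h | h
      · rw [h, sub_self, zero_pow hn0.ne'] at hx'; simp at hx'
      · exact hx1 h
    · intro x hx
      obtain ⟨hx1, hx⟩ := Finset.mem_erase.1 hx
      refine Finset.mem_erase.2 ⟨fun h => hx1 ?_, hinv x hx⟩
      rw [← inv_inv x, h, inv_neg, inv_one]
  rw [Finset.sum_const, nsmul_one, ZMod.natCast_eq_zero_iff] at hpar
  have hcard : cyc (p := p) n 1 1 = #s := rfl
  have hneg : (-1 : ZMod p) ∈ s ↔ (2 : ZMod p) ^ n = 1 := by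
    rw [hmem, hn.neg_one_pow, sub_neg_eq_add, one_add_one_eq_two]; simp
  rw [hcard, ← hneg]
  by_cases hm : (-1 : ZMod p) ∈ s
  · rw [Finset.card_erase_of_mem hm] at hpar
    have : 0 < #s := Finset.card_pos.2 ⟨_, hm⟩
    simp only [hm, iff_true]
    rw [Nat.odd_iff]; omega
  · rw [Finset.erase_eq_of_notMem hm] at hpar
    simp only [hm, iff_false, Nat.not_odd_iff_even, even_iff_two_dvd]
    exact hpar

end JacobiSum

/-! ### The Vandermonde product of consecutive powers of a root of unity -/

section VandermondeRoots

open Finset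

theorem prod_Ioi_eq_prod_range {M : Type*} [CommMonoid M] (n : ℕ) (f : ℕ → ℕ → M) :
    ∏ i : Fin n, ∏ j ∈ Ioi i, f i j = ∏ j ∈ range n, ∏ i ∈ range j, f i j := by
  rw [Finset.prod_comm' (t' := univ) (s' := fun j => Iio j) (by simp)]
  rw [← Fin.prod_univ_eq_prod_range (fun j => ∏ i ∈ range j, f i j)]
  refine Finset.prod_congr rfl fun j _ => ?_
  rw [← Nat.Iio_eq_range, ← Fin.map_valEmbedding_Iio, Finset.prod_map]
  rfl

/-- By the symmetry of `S`, rows `j` and `2h - 1 - j` of the triangle together make one full row;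
there are `h` such pairs. -/
theorem prod_prod_range_symm {M : Type*} [CommMonoid M] (h : ℕ) (S : ℕ → M)
    (hS : ∀ d ≤ 2 * h, S (2 * h - d) = S d) :
    ∏ j ∈ range (2 * h), ∏ d ∈ range j, S (d + 1) = (∏ d ∈ range (2 * h - 1), S (d + 1)) ^ h := by
  have key : ∀ j k, j + k + 1 = 2 * h → (∏ d ∈ range j, S (d + 1)) * ∏ d ∈ range k, S (d + 1) =
      ∏ d ∈ range (2 * h - 1), S (d + 1) := by
    intro j k hjk
    rw [show 2 * h - 1 = j + k by omega, Finset.prod_range_add]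
    congr 1
    rw [← Finset.prod_range_reflect]
    refine Finset.prod_congr rfl fun x hx => ?_
    rw [Finset.mem_range] at hx
    rw [← hS (j + x + 1) (by omega)]
    congr 1
    omega
  rw [two_mul, Finset.prod_range_add, ← Finset.prod_range_reflect (fun x => ∏ d ∈ range (h + x), _),
    ← Finset.prod_mul_distrib, ← two_mul]
  rw [Finset.prod_congr rfl fun x hx => key x (h + (h - 1 - x)) (by
    rw [Finset.mem_range] at hx; omega)]
  simp

theorem two_mul_sum_sum_add (n : ℕ) :
    2 * (∑ j ∈ range n, ∑ i ∈ range j, (i + j + 2)) + n = n ^ 3 := by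
  induction n with
  | zero => simp
  | succ n ih =>
    rw [Finset.sum_range_succ, Finset.sum_add_distrib, Finset.sum_add_distrib]
    simp only [Finset.sum_const, Finset.card_range, smul_eq_mul]
    have := Finset.sum_range_id_mul_two n
    cases n with
    | zero => simp
    | succ m =>
      simp only [Nat.add_sub_cancel] at this
      linear_combination ih + this

/-- The ordered Vandermonde product of the powers of a root of unity `v ^ 2` of order `2h`. -/
theorem prod_sub_pow_sq {F : Type*} [Field F] {n h : ℕ} (hn : n = 2 * h) (hh : 0 < h) {v : F}
    (hv : IsPrimitiveRoot v (4 * h)) :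
    ∏ i : Fin n, ∏ j ∈ Ioi i, ((v ^ 2) ^ ((j : ℕ) + 1) - (v ^ 2) ^ ((i : ℕ) + 1)) =
      -v ^ h * (v ^ h) ^ h * (n : F) ^ h := by
  subst hn
  have hv0 : v ≠ 0 := hv.ne_zero (by omega)
  have hw : IsPrimitiveRoot (v ^ 2) (2 * h) := hv.pow (by omega) (by ring)
  have hv1 : v ^ (2 * h) = -1 := by
    have h2 : IsPrimitiveRoot (v ^ (2 * h)) 2 := hv.pow (by omega) (by ring)
    exact h2.eq_neg_one_of_two_right
  have hvh : v ^ h * v ^ h = -1 := by rw [← pow_add, ← two_mul, hv1]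
  rw [prod_Ioi_eq_prod_range (2 * h) (fun i j => (v ^ 2) ^ (j + 1) - (v ^ 2) ^ (i + 1))]
  -- Taking out the geometric mean gives `v ^ (2j+2) - v ^ (2i+2) = v ^ (i+j+2) * S (j - i)`. This
  -- is why the root of unity is given as a square.
  set S : ℕ → F := fun d => v ^ d - (v⁻¹) ^ d with hS
  have hterm : ∀ j, ∏ i ∈ range j, ((v ^ 2) ^ (j + 1) - (v ^ 2) ^ (i + 1)) =
      v ^ (∑ i ∈ range j, (i + j + 2)) * ∏ d ∈ range j, S (d + 1) := by
    intro j
    rw [← Finset.prod_pow_eq_pow_sum, ← Finset.prod_range_reflect (fun d => S (d + 1)),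
      ← Finset.prod_mul_distrib]
    refine Finset.prod_congr rfl fun i hi => ?_
    rw [Finset.mem_range] at hi
    obtain ⟨k, rfl⟩ := Nat.exists_eq_add_of_lt hi
    rw [hS, show i + k + 1 - 1 - i + 1 = k + 1 by omega, mul_sub,
      show i + (i + k + 1) + 2 = (2 * i + 2) + (k + 1) by ring, pow_add v (2 * i + 2) (k + 1),
      mul_assoc _ _ ((v⁻¹) ^ (k + 1)), ← mul_pow, mul_inv_cancel₀ hv0]
    ring
  rw [Finset.prod_congr rfl fun j _ => hterm j, Finset.prod_mul_distrib,
    Finset.prod_pow_eq_pow_sum, prod_prod_range_symm]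
  · have e1 : v ^ (∑ j ∈ range (2 * h), ∑ i ∈ range j, (i + j + 2)) = -v ^ h := by
      have hs := two_mul_sum_sum_add (2 * h)
      have hs' : (∑ j ∈ range (2 * h), ∑ i ∈ range j, (i + j + 2)) + h = 4 * h * h ^ 2 := by
        linarith
      have hvp : v ^ (∑ j ∈ range (2 * h), ∑ i ∈ range j, (i + j + 2)) * v ^ h = 1 := by
        rw [← pow_add, hs', pow_mul, hv.pow_eq_one, one_pow]
      linear_combination (-v ^ h) * hvp + v ^ (∑ j ∈ range (2 * h), ∑ i ∈ range j, (i + j + 2)) * hvh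
    -- Multiplying `S d` by `v ^ d` turns it into `-(1 - v ^ (2d))`, and `∏ (1 - ω ^ d)` over the
    -- nontrivial powers of a primitive `2h`-th root of unity `ω` is `2h`.
    have e2 : ∏ d ∈ range (2 * h - 1), S (d + 1) = -((2 * h : ℕ) : F) * v ^ h * (-1) ^ h := by
      obtain ⟨m, hm⟩ : ∃ m, 2 * h = m + 1 := ⟨2 * h - 1, by omega⟩
      have hQ : (∏ d ∈ range m, S (d + 1)) * v ^ (∑ d ∈ range m, (d + 1)) =
          ∏ d ∈ range m, -(1 - (v ^ 2) ^ (d + 1)) := by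
        rw [← Finset.prod_pow_eq_pow_sum, ← Finset.prod_mul_distrib]
        refine Finset.prod_congr rfl fun d _ => ?_
        rw [hS, sub_mul, ← mul_pow v⁻¹, inv_mul_cancel₀ hv0]
        ring
      rw [hm] at hw
      rw [Finset.prod_neg, IsPrimitiveRoot.prod_one_sub_pow_eq_order hw, Finset.card_range] at hQ
      have hsum : (∑ d ∈ range m, (d + 1)) + h = 2 * h * h := by
        have h1 := Finset.sum_range_id_mul_two m
        rw [Finset.sum_add_distrib]
        simp only [Finset.sum_const, Finset.card_range, smul_eq_mul, mul_one]
        obtain ⟨k, rfl⟩ : ∃ k, m = k + 1 := ⟨m - 1, by omega⟩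
        simp only [Nat.add_sub_cancel] at h1
        nlinarith
      have hvs : v ^ (∑ d ∈ range m, (d + 1)) * v ^ h = (-1) ^ h := by
        rw [← pow_add, hsum, pow_mul, hv1]
      have hodd : (-1 : F) ^ m = -1 := Odd.neg_one_pow ⟨h - 1, by omega⟩
      rw [hodd] at hQ
      rw [show 2 * h - 1 = m by omega, hm]
      have hsq : ((-1 : F) ^ h) * (-1) ^ h = 1 := by rw [← mul_pow]; simp
      push_cast at hQ ⊢
      linear_combination (v ^ h * (-1) ^ h) * hQ -
        (∏ d ∈ range m, S (d + 1)) * (-1) ^ h * hvs - (∏ d ∈ range m, S (d + 1)) * hsq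
    rw [e1, e2, mul_pow, mul_pow, neg_pow (((2 * h : ℕ) : F)), ← pow_mul (-1 : F)]
    have hsq : ((-1 : F) ^ h) * (-1) ^ (h * h) = 1 := by
      rw [← pow_add]
      exact Even.neg_one_pow (by
        rw [show h + h * h = h * (h + 1) by ring]; exact Nat.even_mul_succ_self h)
    linear_combination (-v ^ h * (v ^ h) ^ h * ((2 * h : ℕ) : F) ^ h) * hsq
  · intro d hd
    have hd1 : v ^ (2 * h - d) * v ^ d = -1 := by rw [← pow_add, Nat.sub_add_cancel hd, hv1]
    have hd2 : v ^ (2 * h - d) = -(v⁻¹) ^ d := by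
      rw [inv_pow]; field_simp; exact hd1
    have hd3 : v⁻¹ ^ (2 * h - d) = -v ^ d := by
      rw [inv_pow, hd2, inv_neg, inv_pow, inv_inv]
    simp only [hS, hd2, hd3]
    ring

end VandermondeRoots

/-! ### Half-class products and the factorization of the differences -/

section HalfSystem

open Finset

variable {p : ℕ} [Fact p.Prime] {n : ℕ}

theorem half_neg_iff (hodd : Odd p) {x : ZMod p} (hx : x ≠ 0) :
    2 * (-x).val < p ↔ ¬ 2 * x.val < p := by
  have : NeZero x := ⟨hx⟩
  have h1 := ZMod.val_neg_of_ne_zero x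
  have h2 := x.val_lt
  obtain ⟨k, hk⟩ := hodd
  omega

/-- The product of the elements `x` of the class `x ^ n = α` represented in `(0, p/2)`. -/
def halfProd (n : ℕ) (α : ZMod p) : ZMod p := ∏ x : ZMod p with x ^ n = α ∧ 2 * x.val < p, x

theorem prod_class_eq_prod_half {M : Type*} [CommMonoid M] (hp : p = 4 * n + 1) (hn : Even n)
    {α : ZMod p} (hα : α ≠ 0) (f : ZMod p → M) :
    ∏ x : ZMod p with x ^ n = α, f x =
      ∏ x : ZMod p with x ^ n = α ∧ 2 * x.val < p, f x * f (-x) := by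
  have hodd : Odd p := ⟨2 * n, by omega⟩
  have hne : ∀ x : ZMod p, x ^ n = α → x ≠ 0 := by
    rintro x hx rfl
    exact hα (by rw [← hx, zero_pow (pos_of_prime_eq hp).ne'])
  rw [Finset.prod_mul_distrib,
    ← Finset.prod_filter_mul_prod_filter_not (univ.filter fun x : ZMod p => x ^ n = α)
      (fun x => 2 * x.val < p), Finset.filter_filter, Finset.filter_filter]
  congr 1
  refine Finset.prod_bij' (fun x _ => -x) (fun x _ => -x) ?_ ?_ (by simp) (by simp) (by simp)
  · intro x hx
    simp only [Finset.mem_filter, Finset.mem_univ, true_and] at hx ⊢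
    exact ⟨by rw [hn.neg_pow, hx.1], (half_neg_iff hodd (hne x hx.1)).2 hx.2⟩
  · intro x hx
    simp only [Finset.mem_filter, Finset.mem_univ, true_and] at hx ⊢
    refine ⟨by rw [hn.neg_pow, hx.1], fun h => (half_neg_iff hodd (hne x hx.1)).1 h hx.2⟩

/-- Pairing `x` with `-x` makes the product of the full class, which is `-α`, equal to `(-1) ^ h`
times the square of the half product. -/
theorem halfProd_sq {h : ℕ} (hp : p = 4 * n + 1) (hn : n = 2 * h) {I : ZMod p} (hI : I ^ 2 = -1)
    {α : ZMod p} (hα : α = 1 ∨ α = -1 ∨ α = I ∨ α = -I) :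
    halfProd n α ^ 2 = -(-1) ^ h * α := by
  subst hn
  have hα0 : α ≠ 0 := by
    obtain ⟨-, -, -, -, -, h6⟩ := fourth_roots_ne hp hI
    rcases hα with rfl | rfl | rfl | rfl <;> simp [h6]
  -- A constant function into `Multiplicative ℤ` turns the product identity into a count: twice the
  -- size of the half class is `n`.
  have hc := prod_class_eq_prod_half hp (even_two_mul h) hα0
    (fun _ => Multiplicative.ofAdd (1 : ℤ))
  simp only [Finset.prod_const, card_pow_eq hp hI hα, ← ofAdd_add, ← ofAdd_nsmul,
    Multiplicative.ofAdd.injective.eq_iff] at hc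
  have hc' : #{x : ZMod p | x ^ (2 * h) = α ∧ 2 * x.val < p} = h := by
    simp only [nsmul_eq_mul] at hc
    push_cast at hc
    omega
  have hP := prod_class_eq_prod_half hp (even_two_mul h) hα0 (fun x => x)
  rw [prod_pow_eq hp (even_two_mul h) hI hα] at hP
  simp only [mul_neg, Finset.prod_neg, hc', Finset.prod_mul_distrib] at hP
  rw [sq, halfProd]
  have hsq : ((-1 : ZMod p) ^ h) * (-1) ^ h = 1 := by rw [← mul_pow]; simp
  linear_combination (-(-1 : ZMod p) ^ h) * hP - (∏ x : ZMod p with x ^ (2 * h) = α ∧ 2 * x.val < p, x) ^ 2 * hsq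

/-- The sign of the least absolute residue. -/
def halfSign (x : ZMod p) : ℤ := if 2 * x.val < p then 1 else -1

/-- `x` itself if its residue lies in `(0, p/2)`, and `1` otherwise. -/
def halfPart (x : ZMod p) : ZMod p := if x ≠ 0 ∧ 2 * x.val < p then x else 1

theorem eq_halfSign_mul (hodd : Odd p) {x : ZMod p} (hx : x ≠ 0) :
    x = halfSign x * (halfPart x * halfPart (-x)) := by
  have h := half_neg_iff hodd hx
  by_cases hc : 2 * x.val < p <;> simp [halfSign, halfPart, hx, h, hc]

/-- Dividing `x - y = d` by `d` gives `u = x / d` and `1 - u = -y / d`, both in the class of `d⁻¹`;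
the resulting number is turned into the one stated by `cyc_comm` and `cyc_inv`. -/
theorem card_sub_eq_cyc (hn : Even n) (hn0 : 0 < n) {d : ZMod p} (hd : d ≠ 0) :
    #{z ∈ (univ.filter fun x : ZMod p => x ^ n = 1) ×ˢ (univ.filter fun x : ZMod p => x ^ n = 1) |
      z.1 - z.2 = d} = cyc n 1 (d ^ n) := by
  have hdn : d ^ n ≠ 0 := pow_ne_zero n hd
  rw [cyc_comm, cyc_inv hn hn0 hdn, one_mul]
  refine Finset.card_bij' (fun z _ => z.1 * d⁻¹) (fun u _ => (d * u, d * u - d)) ?_ ?_ ?_ ?_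
  · rintro ⟨x, y⟩ hz
    simp only [Finset.mem_filter, Finset.mem_product, Finset.mem_univ, true_and] at hz ⊢
    obtain ⟨⟨hx, hy⟩, hxy⟩ := hz
    refine ⟨by rw [mul_pow, hx, inv_pow, one_mul], ?_⟩
    rw [show 1 - x * d⁻¹ = -(y * d⁻¹) by field_simp; rw [← hxy]; ring, hn.neg_pow, mul_pow, hy,
      inv_pow, one_mul]
  · intro u hu
    simp only [Finset.mem_filter, Finset.mem_product, Finset.mem_univ, true_and] at hu ⊢
    refine ⟨⟨by rw [mul_pow, hu.1, mul_inv_cancel₀ hdn], ?_⟩, by ring⟩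
    rw [show d * u - d = -(d * (1 - u)) by ring, hn.neg_pow, mul_pow, hu.2, mul_inv_cancel₀ hdn]
  · rintro ⟨x, y⟩ hz
    simp only [Finset.mem_filter, Finset.mem_product, Finset.mem_univ, true_and] at hz
    have hx : d * (x * d⁻¹) = x := by field_simp
    rw [Prod.mk.injEq]
    refine ⟨hx, ?_⟩
    rw [hx, ← hz.2]; ring
  · intro u hu
    simp only
    field_simp

theorem prod_halfPart_pow (hp : p = 4 * n + 1) {I : ZMod p} (hI : I ^ 2 = -1)
    (m : ZMod p → ℕ) :
    ∏ d : ZMod p, halfPart d ^ m (d ^ n) =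
      halfProd n 1 ^ m 1 * halfProd n (-1) ^ m (-1) * halfProd n I ^ m I *
        halfProd n (-I) ^ m (-I) := by
  obtain ⟨h1, h2, h3, h4, h5, h6⟩ := fourth_roots_ne hp hI
  have h9 : (-1 : ZMod p) ≠ -I := fun h => h2 (neg_injective h)
  simp only [halfProd, ← Finset.prod_pow, Finset.prod_filter, ← Finset.prod_mul_distrib]
  refine Finset.prod_congr rfl fun d _ => ?_
  rcases eq_or_ne d 0 with rfl | hd
  · simp [halfPart, (pos_of_prime_eq hp).ne', h6, h6.symm]
  by_cases hc : 2 * d.val < p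
  · rcases pow_eq_one_or hp hI hd with hx | hx | hx | hx <;>
    simp [halfPart, hd, hx, hc, h1, h2, h3, h4, h5, h9, h1.symm, h2.symm, h3.symm, h4.symm,
      h5.symm, h9.symm]
  · simp [halfPart, hc]

/-- The ordered Vandermonde product of an enumeration of the fourth powers. -/
theorem prod_sub_eq (hp : p = 4 * n + 1) (hn : Even n) {I : ZMod p} (hI : I ^ 2 = -1)
    {A : Fin n → ZMod p} (hA : Function.Injective A) (hA1 : ∀ i, A i ^ n = 1) :
    ∏ i, ∏ j ∈ Ioi i, (A j - A i) =
      ((∏ i, ∏ j ∈ Ioi i, halfSign (A j - A i) : ℤ) : ZMod p) *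
      (halfProd n 1 ^ cyc (p := p) n 1 1 * halfProd n (-1) ^ cyc (p := p) n 1 (-1) *
        halfProd n I ^ cyc n 1 I * halfProd n (-I) ^ cyc n 1 (-I)) := by
  have hodd : Odd p := ⟨2 * n, by omega⟩
  have hn0 := pos_of_prime_eq hp
  have himg : univ.map ⟨A, hA⟩ = univ.filter fun x : ZMod p => x ^ n = 1 := by
    apply Finset.eq_of_subset_of_card_le
    · intro x hx
      obtain ⟨i, -, rfl⟩ := Finset.mem_map.1 hx
      simpa using hA1 i
    · rw [Finset.card_map, card_pow_eq hp hI (by simp)]; simp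
  have hterm : ∀ i, ∀ j ∈ Ioi i, A j - A i =
      (halfSign (A j - A i) : ZMod p) * (halfPart (A j - A i) * halfPart (A i - A j)) := by
    intro i j hj
    have hne : A j - A i ≠ 0 := sub_ne_zero.2 (hA.ne (Finset.mem_Ioi.1 hj).ne')
    have := eq_halfSign_mul hodd hne
    rwa [neg_sub] at this
  rw [Finset.prod_congr rfl fun i _ => Finset.prod_congr rfl (hterm i)]
  rw [Finset.prod_congr rfl fun i _ => Finset.prod_mul_distrib, Finset.prod_mul_distrib]
  simp only [Int.cast_prod]
  congr 1
  -- The two factors `halfPart (±d)` of an unordered pair become one factor for each of its two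
  -- orderings, so the product runs over all ordered pairs and can be grouped by difference.
  rw [Finset.prod_prod_Ioi_mul_eq_prod_prod_off_diag (fun j i => halfPart (A j - A i)),
    ← prod_halfPart_pow hp hI (cyc n 1)]
  -- The diagonal is harmless because `halfPart 0 = 1`, which is the purpose of the condition `x ≠
  -- 0` in its definition.
  have hdiag : ∀ i, ∏ j ∈ ({i}ᶜ : Finset (Fin n)), halfPart (A j - A i) =
      ∏ j, halfPart (A j - A i) := by
    intro i
    rw [← Finset.prod_compl_mul_prod {i}]
    simp [halfPart]
  simp only [hdiag]
  rw [Finset.prod_comm]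
  have hmap : ∏ j, ∏ i, halfPart (A j - A i) =
      ∏ z ∈ (univ.map ⟨A, hA⟩) ×ˢ (univ.map ⟨A, hA⟩), halfPart (z.1 - z.2) := by
    rw [Finset.prod_product, Finset.prod_map]
    simp only [Finset.prod_map, Function.Embedding.coeFn_mk]
  rw [hmap, himg, ← Finset.prod_fiberwise _ (fun z => z.1 - z.2)]
  refine Finset.prod_congr rfl fun d _ => ?_
  rw [Finset.prod_congr rfl fun z hz => by rw [(Finset.mem_filter.1 hz).2], Finset.prod_const]
  rcases eq_or_ne d 0 with rfl | hd
  · simp [halfPart]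
  · rw [card_sub_eq_cyc hn hn0 hd]

/-- `sin (2πd/p)` depends only on `d` modulo `p`; it is positive on residues below `p/2` and
negative on those above. -/
theorem sin_eq_halfSign_mul (hodd : Odd p) {d : ℤ} (hd : (d : ZMod p) ≠ 0) :
    ∃ c : ℝ, 0 < c ∧ Real.sin (2 * Real.pi * d / p) = halfSign (d : ZMod p) * c := by
  have hp0 : (0 : ℝ) < p := by exact_mod_cast (Fact.out : p.Prime).pos
  set r := (d : ZMod p).val with hr
  have hrp : r < p := ZMod.val_lt _
  have hr0 : 0 < r := Nat.pos_of_ne_zero fun h => hd ((ZMod.val_eq_zero _).1 h)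
  obtain ⟨k, hk⟩ : ∃ k : ℤ, d = r + k * p := by
    have h : ((d - r : ℤ) : ZMod p) = 0 := by simp [hr]
    obtain ⟨k, hk⟩ := (ZMod.intCast_zmod_eq_zero_iff_dvd _ _).1 h
    exact ⟨k, by linarith⟩
  have hsin : Real.sin (2 * Real.pi * d / p) = Real.sin (2 * Real.pi * r / p) := by
    rw [← Real.sin_add_int_mul_two_pi (2 * Real.pi * r / p) k, hk]
    congr 1
    push_cast
    field_simp
  have hrp' : (r : ℝ) < p := by exact_mod_cast hrp
  have hr0' : (0 : ℝ) < r := by exact_mod_cast hr0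
  have hpi := Real.pi_pos
  rw [hsin]
  by_cases hc : 2 * r < p
  · have hc' : 2 * (r : ℝ) < p := by exact_mod_cast hc
    refine ⟨_, Real.sin_pos_of_pos_of_lt_pi (x := 2 * Real.pi * r / p) (by positivity) ?_, ?_⟩
    · rw [div_lt_iff₀ hp0]; nlinarith
    · rw [halfSign, if_pos hc]; simp
  · have hc' : (p : ℝ) < 2 * r := by
      obtain ⟨k, hk⟩ := hodd
      have : p < 2 * r := by omega
      exact_mod_cast this
    have heq : Real.sin (2 * Real.pi * r / p) = -Real.sin (2 * Real.pi - 2 * Real.pi * r / p) := by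
      rw [Real.sin_two_pi_sub, neg_neg]
    refine ⟨Real.sin (2 * Real.pi - 2 * Real.pi * r / p),
      Real.sin_pos_of_pos_of_lt_pi ?_ ?_, ?_⟩
    · rw [sub_pos, div_lt_iff₀ hp0]; nlinarith
    · rw [sub_lt_iff_lt_add, ← sub_lt_iff_lt_add', lt_div_iff₀ hp0]; nlinarith
    · rw [halfSign, if_neg hc, heq]; simp

end HalfSystem

theorem tau_spec {p : ℕ} {g : ℤ} (h : ∃ π, IsTau p g π) : IsTau p g (tau p g) := by
  rw [tau, dif_pos h]
  exact h.choose_spec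

/-! ### The enumeration of the half residues and the permutation as a ratio of Vandermonde products
-/

section Tau

open Finset

variable {p : ℕ} [Fact p.Prime] {n : ℕ}

theorem exists_sq_sq_eq (hp : p = 4 * n + 1) {u : ZMod p} (hu : u ^ n = 1) :
    ∃ y : ZMod p, (y ^ 2) ^ 2 = u := by
  have hn0 := pos_of_prime_eq hp
  have hp2 : p / 2 = n * 2 := by omega
  have hu0 : u ≠ 0 := by rintro rfl; simp [hn0.ne'] at hu
  obtain ⟨z, hz⟩ := (ZMod.euler_criterion p hu0).2 (by rw [hp2, pow_mul, hu, one_pow])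
  have hz0 : z ≠ 0 := by rintro rfl; simp [hz] at hu0
  have hzz : z ^ (n * 2) = 1 := by rw [mul_comm, pow_mul, sq, ← hz, hu]
  obtain ⟨y, hy⟩ := (ZMod.euler_criterion p hz0).2 (by rw [hp2, hzz])
  exact ⟨y, by rw [hz, hy]; ring⟩

theorem isHalfResidue_iff {x : ℕ} :
    IsHalfResidue p x ↔ 0 < x ∧ 2 * x < p ∧ ∃ y : ZMod p, y ^ 2 = x := by
  unfold IsHalfResidue
  refine and_congr_right fun _ => and_congr_right fun _ => ⟨?_, ?_⟩
  · rintro ⟨y, hy⟩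
    exact ⟨y, by exact_mod_cast (ZMod.intCast_eq_intCast_iff _ _ _).2 hy⟩
  · rintro ⟨y, hy⟩
    refine ⟨y.val, (ZMod.intCast_eq_intCast_iff _ _ _).1 ?_⟩
    push_cast
    rw [ZMod.natCast_zmod_val, hy]

/-- A fourth power is the square of `±y ^ 2`, one of which lies in `(0, p/2)`; both are quadratic
residues because `-1` is a square. -/
theorem exists_isHalfResidue_sq (hp : p = 4 * n + 1) {u : ZMod p} (hu : u ^ n = 1) :
    ∃ x, IsHalfResidue p x ∧ (x : ZMod p) ^ 2 = u := by
  have hn0 := pos_of_prime_eq hp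
  obtain ⟨y, hy⟩ := exists_sq_sq_eq hp hu
  have hu0 : u ≠ 0 := by rintro rfl; simp [hn0.ne'] at hu
  have hy0 : y ^ 2 ≠ 0 := by rintro h; rw [h] at hy; exact hu0 (by rw [← hy]; simp)
  by_cases hc : 2 * (y ^ 2).val < p
  · refine ⟨(y ^ 2).val, isHalfResidue_iff.2 ⟨?_, hc, y, by rw [ZMod.natCast_zmod_val]⟩,
      by rw [ZMod.natCast_zmod_val, hy]⟩
    exact Nat.pos_of_ne_zero fun h => hy0 ((ZMod.val_eq_zero _).1 h)
  · have hc' := (half_neg_iff ⟨2 * n, by omega⟩ hy0).2 hc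
    obtain ⟨i, hi⟩ : IsSquare (-1 : ZMod p) := ZMod.exists_sq_eq_neg_one_iff.2 (by omega)
    refine ⟨(-y ^ 2).val, isHalfResidue_iff.2 ⟨?_, hc', i * y, ?_⟩, ?_⟩
    · exact Nat.pos_of_ne_zero fun h => neg_ne_zero.2 hy0 ((ZMod.val_eq_zero _).1 h)
    · rw [ZMod.natCast_zmod_val, mul_pow, sq i, ← hi]; ring
    · rw [ZMod.natCast_zmod_val, neg_sq, hy]

/-- The squares of the enumerated half residues, as residue classes. -/
noncomputable def halfResidueSq (p n : ℕ) (i : Fin n) : ZMod p := (halfResidue p i : ZMod p) ^ 2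

theorem halfResidue_mem_and_injOn (hp : p = 4 * n + 1) {I : ZMod p}
    (hI : I ^ 2 = -1) : (∀ i < n, IsHalfResidue p (halfResidue p i)) ∧
      Set.InjOn (halfResidue p) (Set.Iio n) := by
  have hf : (Set.ofPred (IsHalfResidue p)).Finite :=
    (Set.finite_Iio p).subset fun x hx => by
      have h : IsHalfResidue p x := hx
      have := h.2.1
      simp only [Set.mem_Iio]; omega
  -- `Nat.nth` takes the default value `0` beyond the size of a finite set, so there must be at
  -- least `n` half residues; squaring maps them onto the `n` fourth powers.
  have hcard : n ≤ #hf.toFinset := by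
    rw [← card_pow_eq hp hI (α := 1) (by simp)]
    refine (Finset.card_le_card (fun u hu => ?_)).trans
      (Finset.card_image_le (s := hf.toFinset) (f := fun x : ℕ => (x : ZMod p) ^ 2))
    rw [Finset.mem_filter] at hu
    obtain ⟨x, hx, hxu⟩ := exists_isHalfResidue_sq hp hu.2
    exact Finset.mem_image.2 ⟨x, by rw [Set.Finite.mem_toFinset]; exact hx, hxu⟩
  refine ⟨fun i hi => Nat.nth_mem_of_lt_card hf (hi.trans_le hcard), ?_⟩
  exact (Nat.nth_injOn hf).mono (Set.Iio_subset_Iio hcard)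

theorem halfResidueSq_pow (hp : p = 4 * n + 1) {I : ZMod p} (hI : I ^ 2 = -1)
    (i : Fin n) : halfResidueSq p n i ^ n = 1 := by
  obtain ⟨h1, h2, y, hy⟩ := isHalfResidue_iff.1 ((halfResidue_mem_and_injOn hp hI).1 i i.2)
  have hx0 : (halfResidue p i : ZMod p) ≠ 0 := by
    rw [Ne, ZMod.natCast_eq_zero_iff]
    exact Nat.not_dvd_of_pos_of_lt h1 (by omega)
  have hy0 : y ≠ 0 := by rintro rfl; apply hx0; rw [← hy]; simp
  rw [halfResidueSq, ← hy, ← pow_mul, ← pow_mul, show 2 * (2 * n) = p - 1 by omega,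
    ZMod.pow_card_sub_one_eq_one hy0]

theorem halfResidueSq_injective (hp : p = 4 * n + 1) {I : ZMod p}
    (hI : I ^ 2 = -1) : Function.Injective (halfResidueSq p n) := by
  intro i j hij
  obtain ⟨hmem, hinj⟩ := halfResidue_mem_and_injOn hp hI
  have h1 := hmem i i.2
  have h2 := hmem j j.2
  apply Fin.ext
  apply hinj i.2 j.2
  have hi : halfResidue p i < p := by have := h1.2.1; omega
  have hj : halfResidue p j < p := by have := h2.2.1; omega
  rcases sq_eq_sq_iff_eq_or_eq_neg.1 hij with h | h
  · have := congrArg ZMod.val h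
    rwa [ZMod.val_natCast_of_lt hi, ZMod.val_natCast_of_lt hj] at this
  · exfalso
    have h' : ((halfResidue p i + halfResidue p j : ℕ) : ZMod p) = 0 := by
      push_cast; rw [h]; ring
    rw [ZMod.natCast_eq_zero_iff] at h'
    have := Nat.le_of_dvd (by have := h1.1; omega) h'
    have := h1.2.1
    have := h2.2.1
    omega

theorem isTau_iff (g : ℤ) (π : Equiv.Perm (Fin ((p - 1) / 4))) :
    IsTau p g π ↔ ∀ i : Fin ((p - 1) / 4), ((g : ZMod p) ^ 4) ^ ((i : ℕ) + 1) = halfResidueSq p _ (π i) := by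
  refine forall_congr' fun i => ?_
  rw [powerSeq, squareSeq]
  change _ ≡ _ [ZMOD p] ↔ _
  rw [← ZMod.intCast_eq_intCast_iff, halfResidueSq, ← pow_mul]
  push_cast
  rfl

theorem exists_perm_of_injective {α : Type*} [DecidableEq α] {n : ℕ} {f A : Fin n → α}
    (hf : Function.Injective f) (hA : Function.Injective A) (h : ∀ i, ∃ j, A j = f i) :
    ∃! π : Equiv.Perm (Fin n), ∀ i, f i = A (π i) := by
  choose π hπ using h
  have hinj : Function.Injective π := fun i j hij => hf (by rw [← hπ i, ← hπ j, hij])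
  refine ⟨Equiv.ofBijective π (Finite.injective_iff_bijective.1 hinj), fun i => (hπ i).symm, ?_⟩
  intro σ hσ
  ext i
  rw [Equiv.ofBijective_apply, hA ((hσ i).symm.trans (hπ i).symm)]

theorem existsUnique_isTau (hp : p = 4 * ((p - 1) / 4) + 1)
    {I : ZMod p} (hI : I ^ 2 = -1) {g : ℤ} (hg : IsPrimRootMod p g) : ∃! π, IsTau p g π := by
  set n := (p - 1) / 4 with hn_def
  have hn0 := pos_of_prime_eq hp
  have hw : IsPrimitiveRoot ((g : ZMod p) ^ 4) n :=
    IsPrimitiveRoot.pow (by omega) hg (by omega)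
  have hA := halfResidueSq_injective hp hI
  have hA1 := halfResidueSq_pow hp hI
  simp only [isTau_iff]
  generalize (g : ZMod p) ^ 4 = w at hw ⊢
  refine exists_perm_of_injective ?_ hA ?_
  · intro i j hij
    have h0 : w ≠ 0 := hw.ne_zero hn0.ne'
    have hij' : w ^ (i : ℕ) * w = w ^ (j : ℕ) * w := by
      rw [← pow_succ, ← pow_succ]; exact hij
    exact Fin.ext (hw.pow_inj i.2 j.2 (mul_right_cancel₀ h0 hij'))
  · intro i
    have himg : univ.map ⟨halfResidueSq p n, hA⟩ = univ.filter fun x : ZMod p => x ^ n = 1 := by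
      apply Finset.eq_of_subset_of_card_le
      · intro x hx
        obtain ⟨i, -, rfl⟩ := Finset.mem_map.1 hx
        simpa using hA1 i
      · rw [Finset.card_map, card_pow_eq hp hI (by simp)]; simp
    have hmem : w ^ ((i : ℕ) + 1) ∈ univ.filter fun x : ZMod p => x ^ n = 1 := by
      rw [Finset.mem_filter, ← pow_mul, mul_comm, pow_mul, hw.pow_eq_one, one_pow]
      exact ⟨mem_univ _, rfl⟩
    rw [← himg, Finset.mem_map] at hmem
    obtain ⟨j, -, hj⟩ := hmem
    exact ⟨j, hj⟩

theorem sineProd_ne_zero_and_lam (hodd : Odd p)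
    (hA : Function.Injective (halfResidueSq p ((p - 1) / 4))) :
    sineProd p ≠ 0 ∧ (-1 : ℤ) ^ lam p = ∏ i, ∏ j ∈ Ioi i,
      halfSign (halfResidueSq p ((p - 1) / 4) j - halfResidueSq p ((p - 1) / 4) i) := by
  set A := halfResidueSq p ((p - 1) / 4) with hAdef
  have key : ∀ i j : Fin ((p - 1) / 4), ∃ c : ℝ, 0 < c ∧ (j ∈ Ioi i →
      Real.sin (2 * Real.pi * ((halfResidue p j : ℝ) ^ 2 - (halfResidue p i : ℝ) ^ 2) / (p : ℝ)) =
        halfSign (A j - A i) * c) := by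
    intro i j
    by_cases hij : j ∈ Ioi i
    · have hcast : (((halfResidue p j : ℤ) ^ 2 - (halfResidue p i : ℤ) ^ 2 : ℤ) : ZMod p) =
          A j - A i := by
        simp [hAdef, halfResidueSq]
      have hne : A j - A i ≠ 0 := sub_ne_zero.2 (hA.ne (Finset.mem_Ioi.1 hij).ne')
      obtain ⟨c, hc, h⟩ := sin_eq_halfSign_mul hodd (by rw [hcast]; exact hne)
      refine ⟨c, hc, fun _ => ?_⟩
      rw [← hcast, ← h]
      push_cast
      rfl
    · exact ⟨1, one_pos, fun h => absurd h hij⟩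
  choose c hc h using key
  have hU : sineProd p = ((∏ i, ∏ j ∈ Ioi i, halfSign (A j - A i) : ℤ) : ℝ) *
      ∏ i, ∏ j ∈ Ioi i, c i j := by
    rw [sineProd, Finset.prod_congr rfl fun i _ => Finset.prod_congr rfl (h i),
      Finset.prod_congr rfl fun i _ => Finset.prod_mul_distrib, Finset.prod_mul_distrib]
    push_cast
    rfl
  have hcpos : 0 < ∏ i, ∏ j ∈ Ioi i, c i j :=
    Finset.prod_pos fun i _ => Finset.prod_pos fun j _ => hc i j
  have hunit : IsUnit (∏ i, ∏ j ∈ Ioi i, halfSign (A j - A i) : ℤ) := by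
    refine Finset.prod_induction _ IsUnit (fun _ _ => IsUnit.mul) isUnit_one fun i _ => ?_
    refine Finset.prod_induction _ IsUnit (fun _ _ => IsUnit.mul) isUnit_one fun j _ => ?_
    rw [halfSign]; split_ifs <;> simp
  rcases Int.isUnit_iff.1 hunit with h1 | h1
  · rw [h1] at hU ⊢
    have hpos : 0 < sineProd p := by rw [hU]; simpa using hcpos
    exact ⟨hpos.ne', by simp [lam, hpos]⟩
  · rw [h1] at hU ⊢
    have hneg : sineProd p < 0 := by rw [hU]; simpa using hcpos
    exact ⟨hneg.ne, by simp [lam, hneg.not_gt]⟩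

/-- The sign of `τ_p(g)` compares the two Vandermonde products. -/
theorem sign_tau_mul {h : ℕ} (hp : p = 4 * ((p - 1) / 4) + 1) (hh : (p - 1) / 4 = 2 * h)
    {I : ZMod p} (hI : I ^ 2 = -1) {g : ℤ} (hg : IsPrimRootMod p g)
    {π : Equiv.Perm (Fin ((p - 1) / 4))} (hπ : IsTau p g π) :
    ((Equiv.Perm.sign π : ℤ) : ZMod p) * ((-1) ^ lam p *
      (halfProd ((p - 1) / 4) 1 ^ cyc (p := p) ((p - 1) / 4) 1 1 *
        halfProd ((p - 1) / 4) (-1) ^ cyc (p := p) ((p - 1) / 4) 1 (-1) *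
        halfProd ((p - 1) / 4) I ^ cyc ((p - 1) / 4) 1 I *
        halfProd ((p - 1) / 4) (-I) ^ cyc ((p - 1) / 4) 1 (-I))) =
      -(g : ZMod p) ^ ((p - 1) / 4) * ((g : ZMod p) ^ ((p - 1) / 4)) ^ h *
        (((p - 1) / 4 : ℕ) : ZMod p) ^ h := by
  have hn : Even ((p - 1) / 4) := hh ▸ even_two_mul h
  have hn0 := pos_of_prime_eq hp
  have hA := halfResidueSq_injective hp hI
  have hlam := (sineProd_ne_zero_and_lam ⟨2 * ((p - 1) / 4), by omega⟩ hA).2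
  have hV := prod_sub_eq hp hn hI hA (halfResidueSq_pow hp hI)
  rw [← hlam] at hV
  push_cast at hV
  rw [← hV]
  -- Taking `v = g ^ 2` gives `v ^ 2 = g ^ 4` and `v ^ h = g ^ ((p - 1) / 4)`.
  have hv : IsPrimitiveRoot ((g : ZMod p) ^ 2) (4 * h) :=
    IsPrimitiveRoot.pow (by omega) hg (by omega)
  have hD := prod_sub_pow_sq hh (by omega) hv
  rw [← pow_mul (g : ZMod p) 2 h, ← hh] at hD
  rw [← hD]
  have hsign := π.prod_Ioi_comp_eq_sign_mul_prod
    (f := fun i j => halfResidueSq p ((p - 1) / 4) j - halfResidueSq p ((p - 1) / 4) i)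
    (fun i j => by ring)
  rw [← hsign]
  refine Finset.prod_congr rfl fun i _ => Finset.prod_congr rfl fun j _ => ?_
  rw [← (isTau_iff g π).1 hπ, ← (isTau_iff g π).1 hπ]
  ring

end Tau

/-! ### Reduction of signs and exponents -/

section MainTheorem

open Finset

variable {p : ℕ} [Fact p.Prime] {n : ℕ}

theorem signExp_spec {x : ZMod p} (hx : x ^ 2 = 1) : (-1 : ZMod p) ^ signExp x = x := by
  rcases sq_eq_sq_iff_eq_or_eq_neg.1 (hx.trans (one_pow 2).symm) with h | h
  · simp [signExp, h]
  · by_cases h1 : x = 1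
    · simp [signExp, h1]
    · rw [signExp, if_neg h1, pow_one, h]

theorem prod_Omega_cast {ε : ZMod p} (hε : ε ≠ 0) (hn0 : 0 < (p - 1) / 4) :
    ((∏ t ∈ Omega p ε, t : ℕ) : ZMod p) = halfProd ((p - 1) / 4) ε := by
  rw [Nat.cast_prod, halfProd]
  refine Finset.prod_bij' (fun t _ => (t : ZMod p)) (fun x _ => x.val) ?_ ?_ ?_ ?_ ?_
  · intro t ht
    simp only [Omega, Finset.mem_filter, Finset.mem_range, Finset.mem_univ, true_and] at ht ⊢
    rw [ZMod.val_natCast_of_lt ht.1]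
    exact ⟨ht.2.2.2, ht.2.2.1⟩
  · intro x hx
    simp only [Omega, Finset.mem_filter, Finset.mem_range, Finset.mem_univ, true_and] at hx ⊢
    refine ⟨ZMod.val_lt _, Nat.pos_of_ne_zero fun h => ?_, hx.2, by
      rw [ZMod.natCast_zmod_val, hx.1]⟩
    rw [ZMod.val_eq_zero] at h
    rw [h, zero_pow hn0.ne'] at hx
    exact hε hx.1.symm
  · intro t ht
    simp only [Omega, Finset.mem_filter, Finset.mem_range] at ht
    exact ZMod.val_natCast_of_lt ht.1
  · intro x _
    exact ZMod.natCast_zmod_val x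
  · intro t _
    rfl

theorem chi4_two (hp : p = 4 * n + 1) :
    (chi4 p 2 = 1 ∧ (2 : ZMod p) ^ n = 1) ∨ (chi4 p 2 = -1 ∧ (2 : ZMod p) ^ n ≠ 1) := by
  have h2 := zmod_two_ne_zero hp
  have hdvd : ¬ (p : ℤ) ∣ 2 := by
    rw [← ZMod.intCast_zmod_eq_zero_iff_dvd]; exact_mod_cast h2
  have hiff : (∃ x : ℤ, x ^ 4 ≡ 2 [ZMOD p]) ↔ (2 : ZMod p) ^ n = 1 := by
    constructor
    · rintro ⟨x, hx⟩
      have hx' : (x : ZMod p) ^ 4 = 2 := by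
        exact_mod_cast (ZMod.intCast_eq_intCast_iff _ _ _).2 hx
      have hx0 : (x : ZMod p) ≠ 0 := by
        intro h; rw [h] at hx'; apply h2; rw [← hx']; simp
      rw [← hx', ← pow_mul, show 4 * n = p - 1 by omega, ZMod.pow_card_sub_one_eq_one hx0]
    · intro h
      obtain ⟨y, hy⟩ := exists_sq_sq_eq hp h
      refine ⟨y.val, (ZMod.intCast_eq_intCast_iff _ _ _).1 ?_⟩
      push_cast
      rw [ZMod.natCast_zmod_val, ← hy]
      ring
  by_cases h : (2 : ZMod p) ^ n = 1
  · exact Or.inl ⟨by rw [chi4, if_neg hdvd, if_pos (hiff.2 h)], h⟩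
  · exact Or.inr ⟨by rw [chi4, if_neg hdvd, if_neg (fun hh => h (hiff.1 hh))], h⟩

theorem two_pow_sq (hp : p = 4 * n + 1) (hn : Even n) : ((2 : ZMod p) ^ n) ^ 2 = 1 := by
  have hp2 : p ≠ 2 := by omega
  obtain ⟨k, hk⟩ := hn
  have hsq : IsSquare (2 : ZMod p) := (ZMod.exists_sq_eq_two_iff hp2).2 (by omega)
  rw [← pow_mul, show n * 2 = p / 2 by omega]
  exact (ZMod.euler_criterion p (zmod_two_ne_zero hp)).1 hsq

/-- Since `4n = -1` in `ℤ/p`, `2 ^ n * n ^ h = (4n) ^ h = (-1) ^ h`, and `2 ^ n` is its own inverse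
because 2 is a quadratic residue. -/
theorem natCast_pow_half {h : ℕ} (hp : p = 4 * n + 1) (hn : n = 2 * h) :
    (n : ZMod p) ^ h = (-1) ^ h * 2 ^ n := by
  have h4 : (4 : ZMod p) * n = -1 := by
    have : ((4 * n + 1 : ℕ) : ZMod p) = 0 := by rw [← hp]; simp
    push_cast at this
    linear_combination this
  have h1 : (2 : ZMod p) ^ n * (n : ZMod p) ^ h = (-1) ^ h := by
    nth_rw 1 [hn]
    rw [pow_mul, ← mul_pow, ← h4]; norm_num
  have h2 := two_pow_sq hp (hn ▸ even_two_mul h)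
  linear_combination (2 : ZMod p) ^ n * h1 - (n : ZMod p) ^ h * h2

/-- A unit of `ℤ` is determined by its image in `ℤ/p`. -/
theorem units_eq_neg_one_zpow (hp : p = 4 * n + 1) {u : ℤˣ} {N : ℕ} {e : ℤ}
    (hu : ((u : ℤ) : ZMod p) = (-1) ^ N) (he : (2 : ℤ) ∣ e - N) : u = (-1 : ℤˣ) ^ e := by
  have h2 := zmod_two_ne_zero hp
  have h1 : (1 : ZMod p) ≠ -1 := fun h => h2 (by linear_combination h)
  have hN : (-1 : ℤˣ) ^ e = (-1 : ℤˣ) ^ N := by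
    obtain ⟨k, hk⟩ := he
    rw [show e = N + 2 * k by linarith, zpow_add, zpow_mul, zpow_natCast]
    simp
  rw [hN]
  rcases Int.units_eq_one_or u with rfl | rfl <;>
  rcases Nat.even_or_odd N with hN | hN <;> simp [hN.neg_one_pow] at hu ⊢
  · exact h1 hu
  · exact h1 hu.symm

/-- The product of the class products when `4 ∣ b`. -/
theorem classProd_of_even {R : Type*} [CommRing R] {ε I A B P Q : R} (hε : ε ^ 2 = 1)
    (hI : I ^ 2 = -1) (hA : A ^ 2 = ε * 1) (hB : B ^ 2 = ε * -1) (hP : P ^ 2 = ε * I)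
    (hQ : Q ^ 2 = ε * -I) (m c d k : ℕ) :
    A ^ (2 * m + 1) * B ^ (2 * c) * P ^ (2 * (d + 2 * k)) * Q ^ (2 * d) =
      A * ε ^ m * (-ε) ^ c * (-1) ^ k := by
  have h1 : (ε * I) * (ε * -I) = 1 := by linear_combination (-I ^ 2) * hε - hI
  have h2 : (ε * I) ^ 2 = -1 := by rw [mul_pow, hε, hI]; ring
  -- `P ^ 2 * Q ^ 2 = 1` removes the common exponent `d`, and `(P ^ 2) ^ 2 = -1` turns the excess
  -- `2k` into `(-1) ^ k`.
  rw [pow_succ, pow_mul, pow_mul, pow_mul, pow_mul, hA, hB, hP, hQ, pow_add, pow_mul, h2, mul_one,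
    mul_neg_one]
  calc _ = A * ε ^ m * (-ε) ^ c * (-1) ^ k * ((ε * I) * (ε * -I)) ^ d := by
        rw [mul_pow (ε * I)]; ring
    _ = _ := by rw [h1, one_pow, mul_one]

/-- The product of the class products when `b ≡ 2 (mod 4)`. -/
theorem classProd_of_odd {R : Type*} [CommRing R] {ε I A B P Q : R} (hε : ε ^ 2 = 1)
    (hI : I ^ 2 = -1) (hA : A ^ 2 = ε * 1) (hB : B ^ 2 = ε * -1) (hP : P ^ 2 = ε * I)
    (hQ : Q ^ 2 = ε * -I) (m c d k : ℕ) :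
    A ^ (2 * m) * B ^ (2 * c + 1) * P ^ (2 * (d + (2 * k + 1))) * Q ^ (2 * d) =
      (I * B) * ε ^ (m + 1) * (-ε) ^ c * (-1) ^ k := by
  have h1 : (ε * I) * (ε * -I) = 1 := by linear_combination (-I ^ 2) * hε - hI
  have h2 : (ε * I) ^ 2 = -1 := by rw [mul_pow, hε, hI]; ring
  -- Here the excess `2k + 1` is odd, leaving an extra factor `P ^ 2 = ε * I`; this is the origin of
  -- `I * B`.
  rw [pow_mul, pow_succ B, pow_mul, pow_mul, pow_mul, hA, hB, hP, hQ, pow_add, pow_succ (ε * I),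
    pow_mul, h2, mul_one, mul_neg_one]
  calc _ = (I * B) * ε ^ (m + 1) * (-ε) ^ c * (-1) ^ k * ((ε * I) * (ε * -I)) ^ d := by
        rw [mul_pow (ε * I)]; ring
    _ = _ := by rw [h1, one_pow, mul_one]

/-- The exponents: `16 C = p - 3 - 2a` is the cyclotomic number of the class of `-1`, and
`c = ⌊C/2⌋`. -/
theorem cyc_exponents {h : ℕ} (hp : p = 4 * n + 1) (hn : n = 2 * h) {I : ZMod p}
    (hI : I ^ 2 = -1) {a b : ℤ} (hab : (p : ℤ) = a ^ 2 + 4 * b ^ 2) (ha : a ≡ -1 [ZMOD 4])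
    (hb : 0 < b) (hIab : (a : ZMod p) + 2 * b * I = 0) :
    ((2 : ZMod p) ^ n = 1 → ∃ m c d k : ℕ,
      cyc (p := p) n 1 1 = 2 * m + 1 ∧ cyc (p := p) n 1 (-1) = 2 * c ∧
      cyc n 1 I = 2 * (d + 2 * k) ∧ cyc n 1 (-I) = 2 * d ∧
      b = 4 * k ∧ (p : ℤ) - 3 - 2 * a = 32 * c ∧ m + 1 + 3 * c = h) ∧
    ((2 : ZMod p) ^ n ≠ 1 → ∃ m c d k : ℕ,
      cyc (p := p) n 1 1 = 2 * m ∧ cyc (p := p) n 1 (-1) = 2 * c + 1 ∧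
      cyc n 1 I = 2 * (d + (2 * k + 1)) ∧ cyc n 1 (-I) = 2 * d ∧
      b = 4 * k + 2 ∧ (p : ℤ) - 3 - 2 * a = 32 * c + 16 ∧ m + 2 + 3 * c = h) := by
  have hne : Even n := hn ▸ even_two_mul h
  obtain ⟨v1, v2, v3, v4⟩ := cyc_values hp hne hI hab ha hIab
  have hodd := odd_cyc_one_one hp hne
  obtain ⟨b₀, hb₀⟩ : ∃ b₀, b = 2 * b₀ := ⟨cyc (p := p) n 1 I - cyc (p := p) n 1 (-1), by linarith⟩
  obtain ⟨r, hr⟩ : ∃ r, a = 4 * r - 1 := ⟨(a + 1) / 4, by rw [Int.ModEq] at ha; omega⟩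
  -- The number of the class of `-1` has the parity of `b₀ = b / 2`, and that of the class of `1`
  -- the opposite parity; the numbers for `±I` are this number plus or minus `b₀`, hence even.
  have hC : (cyc (p := p) n 1 (-1) : ℤ) = r * (r - 1) + b₀ * b₀ := by
    apply mul_left_cancel₀ (show (16 : ℤ) ≠ 0 by norm_num)
    rw [v1, hab, hr, hb₀]; ring
  obtain ⟨r', hr'⟩ := Int.even_mul_pred_self r
  have hpar : (2 : ℤ) ∣ b₀ * b₀ - b₀ := by
    obtain ⟨z, hz⟩ := Int.even_mul_pred_self b₀
    exact ⟨z, by linear_combination hz⟩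
  obtain ⟨z, hz⟩ := hpar
  refine ⟨fun h2 => ?_, fun h2 => ?_⟩
  · obtain ⟨m, hm⟩ := hodd.2 h2
    refine ⟨m, cyc (p := p) n 1 (-1) / 2, cyc n 1 (-I) / 2, (b / 4).toNat, ?_⟩
    omega
  · obtain ⟨m, hm⟩ := Nat.not_odd_iff_even.1 (mt hodd.1 h2)
    refine ⟨m, cyc (p := p) n 1 (-1) / 2, cyc n 1 (-I) / 2, (b / 4).toNat, ?_⟩
    omega

end MainTheorem

/-! ### Sign formulas and the distribution over primitive roots -/

section SignFormulas

open Finset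

variable {p : ℕ} [Fact p.Prime] {h : ℕ}

theorem primRoot_pow_quarter_sq (hp : p = 4 * ((p - 1) / 4) + 1) {g : ℤ}
    (hg : IsPrimRootMod p g) : ((g : ZMod p) ^ ((p - 1) / 4)) ^ 2 = -1 := by
  have hn0 := pos_of_prime_eq hp
  have h2 : IsPrimitiveRoot ((g : ZMod p) ^ ((p - 1) / 4 * 2)) 2 :=
    IsPrimitiveRoot.pow (by omega) hg (by omega)
  rw [← pow_mul]
  exact h2.eq_neg_one_of_two_right

theorem primRoot_ne_zero (hp : p = 4 * ((p - 1) / 4) + 1) {g : ℤ}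
    (hg : IsPrimRootMod p g) : (g : ZMod p) ≠ 0 := by
  have hn0 := pos_of_prime_eq hp
  exact IsPrimitiveRoot.ne_zero hg (by omega)

theorem pow_mul_self_of_sq_eq_neg_one {R : Type*} [CommRing R] {x : R} (hx : x ^ 2 = -1) :
    (Odd h → x * x ^ h = (-1) ^ (h / 2 + 1)) ∧ (Even h → x * x ^ h = x * (-1) ^ (h / 2)) := by
  constructor
  · rintro ⟨l, rfl⟩
    rw [show (2 * l + 1) / 2 = l by omega, ← hx, ← pow_mul]
    ring
  · rintro ⟨l, rfl⟩
    rw [show (l + l) / 2 = l by omega, ← hx, ← pow_mul]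
    ring

theorem neg_one_pow_sub {R : Type*} [CommRing R] (c m l : ℕ) (hm : m + 1 + 3 * c = l) :
    (Odd l → (-1 : R) ^ m = (-1) ^ c) ∧ (Even l → (-1 : R) ^ m = -(-1) ^ c) := by
  constructor
  · intro hl
    rcases Nat.even_or_odd c with hc | hc <;> rcases Nat.even_or_odd m with hm' | hm' <;>
      simp only [hc.neg_one_pow, hm'.neg_one_pow]
    · grind
    · grind
  · intro hl
    rcases Nat.even_or_odd c with hc | hc <;> rcases Nat.even_or_odd m with hm' | hm' <;>
      simp only [hc.neg_one_pow, hm'.neg_one_pow, neg_neg]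
    · grind
    · grind

theorem halfProd_sq_all (hp : p = 4 * ((p - 1) / 4) + 1) (hh : (p - 1) / 4 = 2 * h)
    {I : ZMod p} (hI : I ^ 2 = -1) :
    halfProd ((p - 1) / 4) (1 : ZMod p) ^ 2 = -(-1) ^ h * 1 ∧
    halfProd ((p - 1) / 4) (-1 : ZMod p) ^ 2 = -(-1) ^ h * -1 ∧
    halfProd ((p - 1) / 4) I ^ 2 = -(-1) ^ h * I ∧
    halfProd ((p - 1) / 4) (-I) ^ 2 = -(-1) ^ h * -I :=
  ⟨halfProd_sq hp hh hI (by simp), halfProd_sq hp hh hI (by simp),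
    halfProd_sq hp hh hI (by simp), halfProd_sq hp hh hI (by simp)⟩

theorem sq_neg_neg_one_pow (R : Type*) [CommRing R] (h : ℕ) : (-(-1 : R) ^ h) ^ 2 = 1 := by
  rw [neg_sq, ← pow_mul, mul_comm, pow_mul]; simp

/-- The sign of `τ_p(g)` when `2` is a fourth power modulo `p`. -/
theorem sign_tau_mul_of_quartic (hp : p = 4 * ((p - 1) / 4) + 1) (hh : (p - 1) / 4 = 2 * h)
    {I : ZMod p} (hI : I ^ 2 = -1) {a b : ℤ} (hab : (p : ℤ) = a ^ 2 + 4 * b ^ 2)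
    (ha : a ≡ -1 [ZMOD 4]) (hb : 0 < b) (hIab : (a : ZMod p) + 2 * b * I = 0)
    (h2 : (2 : ZMod p) ^ ((p - 1) / 4) = 1) :
    ∃ c k : ℕ, b = 4 * k ∧ (p : ℤ) - 3 - 2 * a = 32 * c ∧
      ∀ g : ℤ, IsPrimRootMod p g → ∀ π, IsTau p g π →
        (Odd h → ((Equiv.Perm.sign π : ℤ) : ZMod p) * (-1) ^ (lam p + c + k) *
          halfProd ((p - 1) / 4) 1 = (-1) ^ (h / 2 + 1)) ∧
        (Even h → ((Equiv.Perm.sign π : ℤ) : ZMod p) * (-1) ^ (lam p + c + k) *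
          halfProd ((p - 1) / 4) 1 = (g : ZMod p) ^ ((p - 1) / 4) * (-1) ^ (h / 2)) := by
  obtain ⟨m, c, d, k, e1, e2, e3, e4, hbk, hc, hm⟩ :=
    (cyc_exponents hp hh hI hab ha hb hIab).1 h2
  obtain ⟨q1, q2, q3, q4⟩ := halfProd_sq_all hp hh hI
  refine ⟨c, k, hbk, hc, fun g hg π hπ => ?_⟩
  have key := sign_tau_mul hp hh hI hg hπ
  rw [e1, e2, e3, e4, classProd_of_even (sq_neg_neg_one_pow _ h) hI q1 q2 q3 q4,
    natCast_pow_half hp hh, h2, neg_mul] at key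
  obtain ⟨i1, i2⟩ := pow_mul_self_of_sq_eq_neg_one (h := h) (primRoot_pow_quarter_sq hp hg)
  obtain ⟨j1, j2⟩ := neg_one_pow_sub (R := ZMod p) c m h hm
  refine ⟨fun ho => ?_, fun he => ?_⟩
  · rw [i1 ho, ho.neg_one_pow, neg_neg, one_pow] at key
    rw [pow_add, pow_add]
    linear_combination key
  · rw [i2 he, he.neg_one_pow, j2 he, neg_neg, one_pow] at key
    rw [pow_add, pow_add]
    linear_combination -key

/-- The sign of `τ_p(g)` when `2` is not a fourth power modulo `p`. -/
theorem sign_tau_mul_of_not_quartic (hp : p = 4 * ((p - 1) / 4) + 1) (hh : (p - 1) / 4 = 2 * h)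
    {I : ZMod p} (hI : I ^ 2 = -1) {a b : ℤ} (hab : (p : ℤ) = a ^ 2 + 4 * b ^ 2)
    (ha : a ≡ -1 [ZMOD 4]) (hb : 0 < b) (hIab : (a : ZMod p) + 2 * b * I = 0)
    (h2 : (2 : ZMod p) ^ ((p - 1) / 4) ≠ 1) :
    ∃ c k : ℕ, b = 4 * k + 2 ∧ (p : ℤ) - 3 - 2 * a = 32 * c + 16 ∧
      ∀ g : ℤ, IsPrimRootMod p g → ∀ π, IsTau p g π →
        (Odd h → ((Equiv.Perm.sign π : ℤ) : ZMod p) * (-1) ^ (lam p + c + k) *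
          (I * halfProd ((p - 1) / 4) (-1)) = (-1) ^ (h / 2)) ∧
        (Even h → ((Equiv.Perm.sign π : ℤ) : ZMod p) * (-1) ^ (lam p + c + k) *
          (I * halfProd ((p - 1) / 4) (-1)) =
            (g : ZMod p) ^ ((p - 1) / 4) * (-1) ^ (h / 2 + 1)) := by
  obtain ⟨m, c, d, k, e1, e2, e3, e4, hbk, hc, hm⟩ :=
    (cyc_exponents hp hh hI hab ha hb hIab).2 h2
  obtain ⟨q1, q2, q3, q4⟩ := halfProd_sq_all hp hh hI
  have h2' : (2 : ZMod p) ^ ((p - 1) / 4) = -1 :=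
    (sq_eq_sq_iff_eq_or_eq_neg.1
      ((two_pow_sq hp (hh ▸ even_two_mul h)).trans (one_pow 2).symm)).resolve_left h2
  refine ⟨c, k, hbk, hc, fun g hg π hπ => ?_⟩
  have key := sign_tau_mul hp hh hI hg hπ
  rw [e1, e2, e3, e4, classProd_of_odd (sq_neg_neg_one_pow _ h) hI q1 q2 q3 q4,
    natCast_pow_half hp hh, h2', neg_mul] at key
  obtain ⟨i1, i2⟩ := pow_mul_self_of_sq_eq_neg_one (h := h) (primRoot_pow_quarter_sq hp hg)
  obtain ⟨j1, j2⟩ := neg_one_pow_sub (R := ZMod p) c (m + 1) h hm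
  refine ⟨fun ho => ?_, fun he => ?_⟩
  · rw [i1 ho, ho.neg_one_pow, neg_neg, one_pow] at key
    rw [pow_add, pow_add]
    linear_combination key
  · rw [i2 he, he.neg_one_pow, j2 he, neg_neg, one_pow] at key
    rw [pow_add, pow_add]
    linear_combination -key

theorem eq_neg_one_pow_of_mul {R : Type*} [CommRing R] {s : R} {N M : ℕ}
    (hs : s * (-1) ^ N = (-1) ^ M) : s = (-1) ^ (M + N) := by
  rw [pow_add, ← hs, mul_assoc, ← mul_pow]; simp

/-- For `p ≡ 1 (mod 16)`, inverse primitive roots have permutations of opposite sign. -/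
theorem sign_tau_of_mul_eq_one (hp : p = 4 * ((p - 1) / 4) + 1) (hh : (p - 1) / 4 = 2 * h)
    (he : Even h) {I : ZMod p} (hI : I ^ 2 = -1) {g g' : ℤ} (hg : IsPrimRootMod p g)
    (hg' : IsPrimRootMod p g') (hgg : (g : ZMod p) * g' = 1)
    {π π' : Equiv.Perm (Fin ((p - 1) / 4))} (hπ : IsTau p g π) (hπ' : IsTau p g' π') :
    Equiv.Perm.sign π' = -Equiv.Perm.sign π := by
  have k1 := sign_tau_mul hp hh hI hg hπ
  have k2 := sign_tau_mul hp hh hI hg' hπ'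
  have hι := primRoot_pow_quarter_sq hp hg
  have hιι : (g : ZMod p) ^ ((p - 1) / 4) * (g' : ZMod p) ^ ((p - 1) / 4) = 1 := by
    rw [← mul_pow, hgg, one_pow]
  have hι' : (g' : ZMod p) ^ ((p - 1) / 4) = -(g : ZMod p) ^ ((p - 1) / 4) := by
    linear_combination (g' : ZMod p) ^ ((p - 1) / 4) * hι - (g : ZMod p) ^ ((p - 1) / 4) * hιι
  -- For even `h` the factor `ι ^ h` is unchanged by `ι ↦ -ι`, so the two right-hand sides are
  -- opposite, while the product on the left is the same for `g` and `g'`.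
  rw [hι', he.neg_pow] at k2
  have hg0 := primRoot_ne_zero hp hg
  have h2 := zmod_two_ne_zero hp
  have hr : -(g : ZMod p) ^ ((p - 1) / 4) * ((g : ZMod p) ^ ((p - 1) / 4)) ^ h *
        (((p - 1) / 4 : ℕ) : ZMod p) ^ h ≠ 0 := by
    rw [natCast_pow_half hp hh]
    simp [hg0, h2]
  rw [← k1] at hr
  have hV := right_ne_zero_of_mul hr
  have hsum : ((Equiv.Perm.sign π' : ℤ) : ZMod p) = -((Equiv.Perm.sign π : ℤ) : ZMod p) :=
    mul_right_cancel₀ hV (by linear_combination k1 + k2)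
  have h1 : (1 : ZMod p) ≠ -1 := fun h => h2 (by linear_combination h)
  rcases Int.units_eq_one_or (Equiv.Perm.sign π) with h | h <;>
  rcases Int.units_eq_one_or (Equiv.Perm.sign π') with h' | h' <;> simp [h, h'] at hsum ⊢
  · exact h1 hsum
  · exact h1 hsum.symm

theorem exists_inverse_primRoot (hp : p = 4 * ((p - 1) / 4) + 1) {g : ℤ}
    (hg : IsPrimRootMod p g) :
    IsPrimRootMod p (((g : ZMod p)⁻¹).val : ℤ) ∧ 0 < (((g : ZMod p)⁻¹).val : ℤ) ∧
      (((g : ZMod p)⁻¹).val : ℤ) < p ∧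
      (g : ZMod p) * ((((g : ZMod p)⁻¹).val : ℤ) : ZMod p) = 1 := by
  have hg0 := primRoot_ne_zero hp hg
  have hcast : ((((g : ZMod p)⁻¹).val : ℤ) : ZMod p) = (g : ZMod p)⁻¹ := by simp
  refine ⟨?_, ?_, ?_, ?_⟩
  · rw [IsPrimRootMod, hcast]; exact IsPrimitiveRoot.inv hg
  · rw [Nat.cast_pos, Nat.pos_iff_ne_zero, Ne, ZMod.val_eq_zero]; exact inv_ne_zero hg0
  · exact_mod_cast ZMod.val_lt _
  · rw [hcast, mul_inv_cancel₀ hg0]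

/-- Inversion modulo `p`, with representatives in `(0, p)`, is an involution on the primitive roots
that exchanges the two sets. -/
theorem ncard_sign_eq (hp : p = 4 * ((p - 1) / 4) + 1) (hh : (p - 1) / 4 = 2 * h)
    (he : Even h) {I : ZMod p} (hI : I ^ 2 = -1) :
    {g : ℤ | 0 < g ∧ g < p ∧ IsPrimRootMod p g ∧ Equiv.Perm.sign (tau p g) = 1}.ncard =
      {g : ℤ | 0 < g ∧ g < p ∧ IsPrimRootMod p g ∧ Equiv.Perm.sign (tau p g) = -1}.ncard := by
  have hτ : ∀ g : ℤ, IsPrimRootMod p g → IsTau p g (tau p g) := fun g hg =>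
    tau_spec (existsUnique_isTau hp hI hg).exists
  have hinvinv : ∀ g : ℤ, 0 < g → g < p →
      ((((((g : ZMod p)⁻¹).val : ℤ) : ZMod p)⁻¹).val : ℤ) = g := by
    intro g h0 h1
    lift g to ℕ using h0.le
    simp only [Int.cast_natCast, ZMod.natCast_zmod_val, inv_inv]
    rw [ZMod.val_natCast_of_lt (by exact_mod_cast h1)]
  have hstep : ∀ g : ℤ, IsPrimRootMod p g →
      Equiv.Perm.sign (tau p (((g : ZMod p)⁻¹).val : ℤ)) = -Equiv.Perm.sign (tau p g) := by
    intro g hg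
    obtain ⟨hg', -, -, hgg⟩ := exists_inverse_primRoot hp hg
    exact sign_tau_of_mul_eq_one hp hh he hI hg hg' hgg (hτ g hg) (hτ _ hg')
  refine Set.ncard_congr (fun g _ => (((g : ZMod p)⁻¹).val : ℤ)) ?_ ?_ ?_
  · rintro g ⟨h0, h1, hg, hs⟩
    obtain ⟨hg', hpos, hlt, -⟩ := exists_inverse_primRoot hp hg
    exact ⟨hpos, hlt, hg', by rw [hstep g hg, hs]⟩
  · rintro g g' ⟨h0, h1, -⟩ ⟨h0', h1', -⟩ heq
    rw [← hinvinv g h0 h1, ← hinvinv g' h0' h1']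
    exact congrArg (fun z : ℤ => (((z : ZMod p)⁻¹).val : ℤ)) heq
  · rintro g ⟨h0, h1, hg, hs⟩
    obtain ⟨hg', hpos, hlt, -⟩ := exists_inverse_primRoot hp hg
    exact ⟨_, ⟨hpos, hlt, hg', by rw [hstep g hg, hs, neg_neg]⟩, hinvinv g h0 h1⟩

end SignFormulas

/-! ### Assembly of the two congruence cases -/

theorem theorem1p1 (p : ℕ) [Fact p.Prime] (hp : p % 8 = 1) (a b : ℤ)
    (hab : (p : ℤ) = a ^ 2 + 4 * b ^ 2) (ha : a ≡ -1 [ZMOD 4]) (hb : 0 < b) :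
    -- the objects are well defined
    (∀ g : ℤ, IsPrimRootMod p g → (∃! π, IsTau p g π) ∧ IsTau p g (tau p g)) ∧
    sineProd p ≠ 0 ∧
    -- the case `p ≡ 9 (mod 16)`
    (p % 16 = 9 →
      (-1 : ZMod p) ^ beta p = (prodA p : ZMod p) ∧
      (-1 : ZMod p) ^ gamma p a b = 2 * (b : ZMod p) * (prodB p : ZMod p) / (a : ZMod p) ∧
      (∀ g g' : ℤ, IsPrimRootMod p g → IsPrimRootMod p g' →
        Equiv.Perm.sign (tau p g) = Equiv.Perm.sign (tau p g')) ∧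
      (∀ g : ℤ, IsPrimRootMod p g →
        (chi4 p 2 = 1 →
          (32 : ℤ) ∣ 3 * (p : ℤ) + 11 - 2 * a + 8 * b ∧
          Equiv.Perm.sign (tau p g) =
            (-1 : ℤˣ) ^ ((lam p : ℤ) + (beta p : ℤ) +
              (3 * (p : ℤ) + 11 - 2 * a + 8 * b) / 32)) ∧
        (chi4 p 2 = -1 →
          (32 : ℤ) ∣ 3 * (p : ℤ) - 21 - 2 * a - 8 * b ∧
          Equiv.Perm.sign (tau p g) =
            (-1 : ℤˣ) ^ ((lam p : ℤ) + (gamma p a b : ℤ) +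
              (3 * (p : ℤ) - 21 - 2 * a - 8 * b) / 32)))) ∧
    -- the case `p ≡ 1 (mod 16)`
    (p % 16 = 1 →
      (∀ g : ℤ, IsPrimRootMod p g →
        (-1 : ZMod p) ^ delta p g = (prodA p : ZMod p) / (g : ZMod p) ^ ((p - 1) / 4) ∧
        (-1 : ZMod p) ^ mu p a b g =
          2 * (b : ZMod p) * (prodB p : ZMod p) /
            ((a : ZMod p) * (g : ZMod p) ^ ((p - 1) / 4)) ∧
        (chi4 p 2 = 1 →
          (32 : ℤ) ∣ 3 * (p : ℤ) - 5 - 2 * a + 8 * b ∧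
          Equiv.Perm.sign (tau p g) =
            (-1 : ℤˣ) ^ ((lam p : ℤ) + (delta p g : ℤ) +
              (3 * (p : ℤ) - 5 - 2 * a + 8 * b) / 32)) ∧
        (chi4 p 2 = -1 →
          (32 : ℤ) ∣ 3 * (p : ℤ) + 27 - 2 * a - 8 * b ∧
          Equiv.Perm.sign (tau p g) =
            (-1 : ℤˣ) ^ ((lam p : ℤ) + (mu p a b g : ℤ) +
              (3 * (p : ℤ) + 27 - 2 * a - 8 * b) / 32))) ∧
      {g : ℤ | 0 < g ∧ g < p ∧ IsPrimRootMod p g ∧ Equiv.Perm.sign (tau p g) = 1}.ncard =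
        {g : ℤ | 0 < g ∧ g < p ∧ IsPrimRootMod p g ∧ Equiv.Perm.sign (tau p g) = -1}.ncard) := by
  have hp4 : p = 4 * ((p - 1) / 4) + 1 := by omega
  obtain ⟨h, hh⟩ : ∃ h, (p - 1) / 4 = 2 * h := ⟨(p - 1) / 8, by omega⟩
  have hn0 := pos_of_prime_eq hp4
  have h2 := zmod_two_ne_zero hp4
  have habz : (a : ZMod p) ^ 2 + 4 * b ^ 2 = 0 := by
    have := congrArg (Int.cast : ℤ → ZMod p) hab
    push_cast at this
    rw [← this]; simp
  have hbp : b < p := by nlinarith [sq_nonneg a]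
  have hb0 : (b : ZMod p) ≠ 0 := by
    rw [Ne, ZMod.intCast_zmod_eq_zero_iff_dvd]
    exact fun hd => by have := Int.le_of_dvd hb hd; omega
  have ha0 : (a : ZMod p) ≠ 0 := by
    intro h0
    rw [h0] at habz
    have : (2 * b : ZMod p) ^ 2 = 0 := by linear_combination habz
    exact mul_ne_zero h2 hb0 (pow_eq_zero_iff two_ne_zero |>.1 this)
  -- Of the two square roots of `-1` this one satisfies `a + 2bI = 0`, as `cyc_values` requires, and
  -- makes the quantity defining `γ_p` equal to `I * halfProd n (-1)`.
  obtain ⟨I, hI_def⟩ : ∃ I : ZMod p, I = 2 * b / a := ⟨_, rfl⟩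
  have hI : I ^ 2 = -1 := by
    rw [hI_def]; field_simp; linear_combination habz
  have hIab : (a : ZMod p) + 2 * b * I = 0 := by
    rw [hI_def]; field_simp; linear_combination habz
  have hA : (prodA p : ZMod p) = halfProd ((p - 1) / 4) 1 := prod_Omega_cast one_ne_zero hn0
  have hB : (prodB p : ZMod p) = halfProd ((p - 1) / 4) (-1) :=
    prod_Omega_cast (neg_ne_zero.2 one_ne_zero) hn0
  have hIB : 2 * (b : ZMod p) * (prodB p : ZMod p) / (a : ZMod p) =
      I * halfProd ((p - 1) / 4) (-1) := by
    rw [hB, hI_def]; ring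
  obtain ⟨q1, q2, -, -⟩ := halfProd_sq_all hp4 hh hI
  have hτ : ∀ g : ℤ, IsPrimRootMod p g → (∃! π, IsTau p g π) ∧ IsTau p g (tau p g) := fun g hg =>
    ⟨existsUnique_isTau hp4 hI hg, tau_spec (existsUnique_isTau hp4 hI hg).exists⟩
  have hlam := sineProd_ne_zero_and_lam ⟨2 * ((p - 1) / 4), by omega⟩
    (halfResidueSq_injective hp4 hI)
  have hquart : chi4 p 2 = 1 → (2 : ZMod p) ^ ((p - 1) / 4) = 1 := fun hc => by
    rcases chi4_two hp4 with ⟨_, h'⟩ | ⟨h', _⟩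
    · exact h'
    · rw [hc] at h'; norm_num at h'
  have hnquart : chi4 p 2 = -1 → (2 : ZMod p) ^ ((p - 1) / 4) ≠ 1 := fun hc => by
    rcases chi4_two hp4 with ⟨h', _⟩ | ⟨_, h'⟩
    · rw [hc] at h'; norm_num at h'
    · exact h'
  refine ⟨hτ, hlam.1, fun h9 => ?_, fun h1 => ?_⟩
  · have ho : Odd h := by rw [Nat.odd_iff]; omega
    rw [ho.neg_one_pow, neg_neg, one_mul] at q1 q2
    have hβ : (-1 : ZMod p) ^ beta p = (prodA p : ZMod p) :=
      signExp_spec (by rw [hA, q1])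
    have hγ : (-1 : ZMod p) ^ gamma p a b =
        2 * (b : ZMod p) * (prodB p : ZMod p) / (a : ZMod p) :=
      signExp_spec (by rw [hIB, mul_pow, hI, q2]; ring)
    have hform : ∀ g : ℤ, IsPrimRootMod p g →
        (chi4 p 2 = 1 →
          (32 : ℤ) ∣ 3 * (p : ℤ) + 11 - 2 * a + 8 * b ∧
          Equiv.Perm.sign (tau p g) =
            (-1 : ℤˣ) ^ ((lam p : ℤ) + (beta p : ℤ) +
              (3 * (p : ℤ) + 11 - 2 * a + 8 * b) / 32)) ∧
        (chi4 p 2 = -1 →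
          (32 : ℤ) ∣ 3 * (p : ℤ) - 21 - 2 * a - 8 * b ∧
          Equiv.Perm.sign (tau p g) =
            (-1 : ℤˣ) ^ ((lam p : ℤ) + (gamma p a b : ℤ) +
              (3 * (p : ℤ) - 21 - 2 * a - 8 * b) / 32)) := by
      intro g hg
      obtain ⟨l, rfl⟩ := ho
      refine ⟨fun hc => ?_, fun hc => ?_⟩
      · obtain ⟨c, k, hbk, hac, hs⟩ :=
          sign_tau_mul_of_quartic hp4 hh hI hab ha hb hIab (hquart hc)
        have hs := (hs g hg _ (hτ g hg).2).1 ⟨l, rfl⟩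
        rw [← hA, ← hβ, mul_assoc, ← pow_add] at hs
        -- Substituting `p = 16l + 9`, `2a = p - 3 - 32c` and `b = 4k`, the fraction equals `l + 1 +
        -- c + k`; the other three cases are checked in the same way.
        exact ⟨by omega, units_eq_neg_one_zpow hp4 (eq_neg_one_pow_of_mul hs)
          (by push_cast; omega)⟩
      · obtain ⟨c, k, hbk, hac, hs⟩ :=
          sign_tau_mul_of_not_quartic hp4 hh hI hab ha hb hIab (hnquart hc)
        have hs := (hs g hg _ (hτ g hg).2).1 ⟨l, rfl⟩
        rw [← hIB, ← hγ, mul_assoc, ← pow_add] at hs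
        exact ⟨by omega, units_eq_neg_one_zpow hp4 (eq_neg_one_pow_of_mul hs)
          (by push_cast; omega)⟩
    refine ⟨hβ, hγ, fun g g' hg hg' => ?_, hform⟩
    rcases chi4_two hp4 with ⟨hc, -⟩ | ⟨hc, -⟩
    · rw [((hform g hg).1 hc).2, ((hform g' hg').1 hc).2]
    · rw [((hform g hg).2 hc).2, ((hform g' hg').2 hc).2]
  · have he : Even h := by rw [Nat.even_iff]; omega
    rw [he.neg_one_pow, neg_one_mul] at q1 q2
    refine ⟨fun g hg => ?_, ncard_sign_eq hp4 hh he hI⟩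
    have hι := primRoot_pow_quarter_sq hp4 hg
    have hι0 : (g : ZMod p) ^ ((p - 1) / 4) ≠ 0 := pow_ne_zero _ (primRoot_ne_zero hp4 hg)
    have hδ : (-1 : ZMod p) ^ delta p g = (prodA p : ZMod p) / (g : ZMod p) ^ ((p - 1) / 4) :=
      signExp_spec (by rw [div_pow, hA, q1, hι]; simp)
    have hIB' : 2 * (b : ZMod p) * (prodB p : ZMod p) /
        ((a : ZMod p) * (g : ZMod p) ^ ((p - 1) / 4)) =
          I * halfProd ((p - 1) / 4) (-1) / (g : ZMod p) ^ ((p - 1) / 4) := by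
      rw [← hIB, div_div]
    have hμ : (-1 : ZMod p) ^ mu p a b g = 2 * (b : ZMod p) * (prodB p : ZMod p) /
        ((a : ZMod p) * (g : ZMod p) ^ ((p - 1) / 4)) :=
      signExp_spec (by rw [hIB', div_pow, mul_pow, hI, q2, hι]; simp)
    refine ⟨hδ, hμ, fun hc => ?_, fun hc => ?_⟩
    · obtain ⟨c, k, hbk, hac, hs⟩ :=
        sign_tau_mul_of_quartic hp4 hh hI hab ha hb hIab (hquart hc)
      have hs := (hs g hg _ (hτ g hg).2).2 he
      obtain ⟨l, rfl⟩ := he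
      rw [← hA, ← (eq_div_iff hι0).1 hδ] at hs
      have hs' : ((Equiv.Perm.sign (tau p g) : ℤ) : ZMod p) *
          -- Replacing `A_p` by `(-1) ^ δ * ι` puts `ι` on both sides, where it cancels.
          (-1) ^ (lam p + c + k + delta p g) = (-1) ^ ((l + l) / 2) :=
        mul_right_cancel₀ hι0 (by rw [pow_add _ (lam p + c + k)]; linear_combination hs)
      exact ⟨by omega, units_eq_neg_one_zpow hp4 (eq_neg_one_pow_of_mul hs')
        (by push_cast; omega)⟩
    · obtain ⟨c, k, hbk, hac, hs⟩ :=
        sign_tau_mul_of_not_quartic hp4 hh hI hab ha hb hIab (hnquart hc)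
      have hs := (hs g hg _ (hτ g hg).2).2 he
      obtain ⟨l, rfl⟩ := he
      rw [hIB'] at hμ
      rw [← (eq_div_iff hι0).1 hμ] at hs
      have hs' : ((Equiv.Perm.sign (tau p g) : ℤ) : ZMod p) *
          (-1) ^ (lam p + c + k + mu p a b g) = (-1) ^ ((l + l) / 2 + 1) :=
        mul_right_cancel₀ hι0 (by rw [pow_add _ (lam p + c + k)]; linear_combination hs)
      exact ⟨by omega, units_eq_neg_one_zpow hp4 (eq_neg_one_pow_of_mul hs')
        (by push_cast; omega)⟩
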